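/- Let $M$ be a smooth $n$-dimensional manifold (Hausdorff, second countable, without boundary), $A^k(M)=\Gamma(\wedge^kTM)$ and $\mathcal A(M)=\bigoplus_{k\ge 0}A^k(M)$ (with $A^{-1}(M)=0$), and let $[\cdot,\cdot]$ be the Schouten–Nijenhuis bracket of multivector fields, with the sign convention $[P,Q]=-(-1)^{(p-1)(q-1)}[Q,P]$ and $[P,Q\wedge R]=[P,Q]\wedge R+(-1)^{(p-1)q}Q\wedge[P,R]$ for $P\in A^p(M)$, $Q\in A^q(M)$, $R\in\mathcal A(M)$, extending $[X,f]=X(f)$ and the Lie bracket of vector fields. A *higher affine connection* on $M$ is a map $\nabla:\mathcal A(M)\times\mathcal A(M)\to\mathcal A(M)$, $(X,Y)\mapsto\nabla_XY$, such that (i) $\nabla_XY\in A^{k+l-1}(M)$ for $X\in A^k(M)$, $Y\in A^l(M)$; (ii) $\nabla_{fX+X'}Y=f\nabla_XY+\nabla_{X'}Y$ for $f\in C^\infty(M)$, $X,X',Y\in\mathcal A(M)$; (iii) $\nabla_X(Y+Y')=\nabla_XY+\nabla_XY'$ for $X,Y,Y'\in\mathcal A(M)$; (iv) $\nabla_Xf=[X,f]$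 for $X\in A^k(M)$, $f\in C^\infty(M)$; (v) $\nabla_X(fY)=[X,f]\wedge Y+f\nabla_XY$ for $X\in A^k(M)$, $f\in C^\infty(M)$, $Y\in\mathcal A(M)$; (vi) $\nabla_fX=0$ for $f\in C^\infty(M)$, $X\in\mathcal A(M)$. It is *induced* if, for all $X\in A^k(M)$, $Y\in A^l(M)$, $Z\in\mathcal A(M)$, $$\nabla_{X\wedge Y}Z=X\wedge\nabla_YZ+(-1)^{kl}\,Y\wedge\nabla_XZ,\qquad \nabla_X(Y\wedge Z)=(\nabla_XY)\wedge Z+(-1)^{(k-1)l}\,Y\wedge\nabla_XZ .$$ **Theorem 3.1.** Every affine connection $\widetilde\nabla$ on $TM$ extends uniquely from $A^1(M)\times A^1(M)$ to an induced higher affine connection, again denoted $\widetilde\nabla$. Let $\mathcal P$ be the set of pairs $(\widetilde\nabla,\{F^{k,l}\})$ consisting of an affine connection $\widetilde\nabla$ on $TM$ and a family of smooth sections $F^{k,l}$ of $E^{k,l}=\wedge^{k+l-1}TM\otimes\wedge^kT^*M\otimes\wedge^lT^*M$, one for each pair $k,l>0$ with $k+l-1\le n$, such that $F^{1,1}\equiv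 0$. Consider the relation $$\nabla_XY=\widetilde\nabla_XY+F^{k,l}(X,Y)\qquad\text{for all } k,l>0 \text{ with } k+l-1\le n,\ X\in A^k(M),\ Y\in A^l(M).\tag{$*$}$$ For every higher affine connection $\nabla$ there is a unique pair $(\widetilde\nabla,\{F^{k,l}\})\in\mathcal P$ satisfying $(*)$. Conversely, for every pair in $\mathcal P$ there is a unique higher affine connection $\nabla$ satisfying $(*)$. In particular, $(*)$ defines a bijection between the set of all higher affine connections on $M$ and $\mathcal P$. -/

import Mathlib

open scoped Manifold ContDiff Bundle

noncomputable section

namespace HigherConn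

/-- The model space `ℝⁿ`. -/
abbrev Eu (n : ℕ) : Type := EuclideanSpace ℝ (Fin n)

/-- The exterior algebra of a finite-dimensional vector space is finite-dimensional. -/
instance extFinite (V : Type*) [AddCommGroup V] [Module ℝ V] [Module.Finite ℝ V] :
    Module.Finite ℝ (ExteriorAlgebra ℝ V) := by
  have hzero : ∀ k : ℕ, Module.finrank ℝ V < k →
      (⋀[ℝ]^k V : Submodule ℝ (ExteriorAlgebra ℝ V)) = ⊥ := by
    intro k hk
    have h : Module.finrank ℝ (⋀[ℝ]^k V) = 0 := by
      rw [exteriorPower.finrank_eq, Nat.choose_eq_zero_of_lt hk]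
    exact Submodule.finrank_eq_zero.mp h
  have htop : (⊤ : Submodule ℝ (ExteriorAlgebra ℝ V)) =
      ⨆ i : Fin (Module.finrank ℝ V + 1), (⋀[ℝ]^(i : ℕ) V) := by
    rw [← (DirectSum.Decomposition.isInternal
      (fun k : ℕ => (⋀[ℝ]^k V : Submodule ℝ (ExteriorAlgebra ℝ V)))).submodule_iSup_eq_top]
    apply le_antisymm
    · refine iSup_le fun k => ?_
      by_cases hk : Module.finrank ℝ V < k
      · rw [hzero k hk]; exact bot_le
      · exact le_iSup (fun i : Fin (Module.finrank ℝ V + 1) =>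
          (⋀[ℝ]^(i : ℕ) V : Submodule ℝ (ExteriorAlgebra ℝ V))) ⟨k, by omega⟩
    · exact iSup_le fun i =>
        le_iSup (fun k : ℕ => (⋀[ℝ]^k V : Submodule ℝ (ExteriorAlgebra ℝ V))) (i : ℕ)
  refine ⟨?_⟩
  rw [htop]
  exact Submodule.fg_iSup _ fun i => Module.Finite.iff_fg.mp inferInstance

section Manifold

variable (n : ℕ) (M : Type*) [TopologicalSpace M] [ChartedSpace (Eu n) M]

/-- The tangent space `T_pM`. -/
abbrev Tan {M : Type*} [TopologicalSpace M] [ChartedSpace (Eu n) M] (p : M) : Type :=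
  TangentSpace (𝓡 n) p

/-- The ring `C^∞(M)`. -/
abbrev SmoothFun : Type _ := C^∞⟮𝓡 n, M; 𝓘(ℝ, ℝ), ℝ⟯

variable {M} in
/-- Smoothness at `p` of a map from `M` into a finite-dimensional real vector space `W` (which
need not carry a chosen norm): every linear functional of the map is smooth at `p`. -/
def SmoothAt {W : Type*} [AddCommGroup W] [Module ℝ W] (g : M → W) (p : M) : Prop :=
  ∀ ξ : Module.Dual ℝ W, ContMDiffAt (𝓡 n) 𝓘(ℝ, ℝ) ∞ (fun q => ξ (g q)) p

variable {n} {M} in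
theorem SmoothAt.mul {a b : M → ExteriorAlgebra ℝ (Eu n)} {p : M}
    (ha : SmoothAt n a p) (hb : SmoothAt n b p) : SmoothAt n (fun q => a q * b q) p := by
  intro ξ
  let B := Module.finBasis ℝ (ExteriorAlgebra ℝ (Eu n))
  have key : (fun q => ξ (a q * b q)) =
      fun q => ∑ i, ∑ j, (B.coord i (a q) * B.coord j (b q)) * ξ (B i * B j) := by
    funext q
    conv_lhs => rw [← B.sum_repr (a q), ← B.sum_repr (b q)]
    simp only [Finset.sum_mul, Finset.mul_sum, map_sum, smul_mul_assoc, mul_smul_comm, map_smul,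
      smul_eq_mul, Module.Basis.coord_apply]
    rw [Finset.sum_comm]
    refine Finset.sum_congr rfl fun i _ => Finset.sum_congr rfl fun j _ => ?_
    ring
  rw [key]
  refine ContMDiffAt.sum fun i _ => ContMDiffAt.sum fun j _ => ?_
  exact ((ha (B.coord i)).mul (hb (B.coord j))).mul contMDiffAt_const

variable [IsManifold (𝓡 n) ∞ M]

/-- The space `Γ(TM)` of smooth vector fields. -/
abbrev VectorField : Type _ := Cₛ^∞⟮𝓡 n; Eu n, (TangentSpace (𝓡 n) : M → Type)⟯

variable {M}

/-- `T_qM → ℝⁿ`, the linear part at `q` of the local trivialization of `TM` given by the preferred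
chart around `p` (an isomorphism for `q` in the domain of that chart). -/
def triv (p q : M) : Tan n q →ₗ[ℝ] Eu n :=
  ((trivializationAt (Eu n) (TangentSpace (𝓡 n) : M → Type) p).continuousLinearMapAt ℝ q :
    Tan n q →L[ℝ] Eu n)

/-- The inverse `ℝⁿ → T_qM` of `triv n p q`, for `q` in the domain of the preferred chart
around `p`. -/
def trivInv (p q : M) : Eu n →ₗ[ℝ] Tan n q :=
  ((trivializationAt (Eu n) (TangentSpace (𝓡 n) : M → Type) p).symmL ℝ q :
    Eu n →L[ℝ] Tan n q)

/-- The representation of a section `X` of `∧^• TM` in the local trivialization of `∧^• TM`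
induced by the preferred chart around `p`. -/
def localRep (p : M) (X : Π q : M, ExteriorAlgebra ℝ (Tan n q)) (q : M) :
    ExteriorAlgebra ℝ (Eu n) :=
  ExteriorAlgebra.map (triv n p q) (X q)

/-- A section of `∧^• TM` is smooth if its local representations are. -/
def IsSmoothSection (X : Π q : M, ExteriorAlgebra ℝ (Tan n q)) : Prop :=
  ∀ p : M, SmoothAt n (localRep n p X) p

variable (M) in
/-- The algebra `𝒜(M) = ⨁ₖ Γ(∧ᵏ TM)` of multivector fields, realised as the algebra `Γ(∧^• TM)` of
smooth sections of the full exterior bundle; the product is the wedge product. -/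
def MVF : Subalgebra ℝ (Π p : M, ExteriorAlgebra ℝ (Tan n p)) where
  carrier := {X | IsSmoothSection n X}
  mul_mem' := by
    intro X Y hX hY p
    have h : localRep n p (X * Y) = fun q => localRep n p X q * localRep n p Y q := by
      funext q; simp [localRep]
    rw [h]
    exact (hX p).mul (hY p)
  add_mem' := by
    intro X Y hX hY p ξ
    have h : (fun q => ξ (localRep n p (X + Y) q)) =
        fun q => ξ (localRep n p X q) + ξ (localRep n p Y q) := by
      funext q; simp [localRep]
    rw [h]
    exact (hX p ξ).add (hY p ξ)
  algebraMap_mem' := by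
    intro c p ξ
    have h : (fun q => ξ (localRep n p (algebraMap ℝ _ c) q)) =
        fun _ => ξ (algebraMap ℝ _ c) := by
      funext q; simp [localRep, Pi.algebraMap_apply]
    rw [h]
    exact contMDiffAt_const

/-- `X ∈ Aᵏ(M)`: the multivector field `X` is homogeneous of degree `k`. -/
def HasDegree (k : ℕ) (X : MVF n M) : Prop :=
  ∀ p : M, X.1 p ∈ ⋀[ℝ]^k (Tan n p)

/-- A function, as a multivector field of degree `0`. In particular `fX` is `ofFun f * X`. -/
def ofFun (f : SmoothFun n M) : MVF n M :=
  ⟨fun p => algebraMap ℝ _ (f p), by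
    intro p ξ
    have h : (fun q => ξ (localRep n p (fun p => algebraMap ℝ _ (f p)) q)) =
        fun q => f q * ξ 1 := by
      funext q; simp [localRep, Algebra.algebraMap_eq_smul_one]
    rw [h]
    exact (f.contMDiff p).mul contMDiffAt_const⟩

/-- A vector field, as a multivector field of degree `1`. -/
def ofVF (X : VectorField n M) : MVF n M :=
  ⟨fun p => ExteriorAlgebra.ι ℝ (X p), by
    intro p ξ
    have h : (fun q => ξ (localRep n p (fun p => ExteriorAlgebra.ι ℝ (X p)) q)) =
        fun q => LinearMap.toContinuousLinearMap (ξ ∘ₗ ExteriorAlgebra.ι ℝ) (triv n p q (X q)) := by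
      funext q; simp [localRep]
    rw [h]
    have hX := (X.contMDiff p)
    rw [Bundle.contMDiffAt_section] at hX
    have h2 : ContMDiffAt (𝓡 n) 𝓘(ℝ, Eu n) ∞ (fun q => triv n p q (X q)) p := by
      refine hX.congr_of_eventuallyEq ?_
      have hb := (trivializationAt (Eu n) (TangentSpace (𝓡 n) : M → Type) p).open_baseSet.mem_nhds
        (FiberBundle.mem_baseSet_trivializationAt' p)
      filter_upwards [hb] with q hq
      simp only [triv, ContinuousLinearMap.coe_coe]
      rw [Bundle.Trivialization.continuousLinearMapAt_apply_of_mem (R := ℝ) _ hq]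
    exact (ContinuousLinearMap.contMDiff _).contMDiffAt.comp p h2⟩

/-- `fX` for a function `f` and a vector field `X`. -/
def funSMul (f : SmoothFun n M) (X : VectorField n M) : VectorField n M :=
  ⟨fun p => f p • X p, f.contMDiff.smul_section X.contMDiff⟩

/-- The partial derivative `∂_i g` at `x` of a map `g : ℝⁿ → ∧^• ℝⁿ`, taken componentwise in a
basis of `∧^• ℝⁿ`. -/
def partialDeriv (g : Eu n → ExteriorAlgebra ℝ (Eu n)) (x : Eu n) (i : Fin n) :
    ExteriorAlgebra ℝ (Eu n) :=
  ∑ b, fderiv ℝ (fun y => (Module.finBasis ℝ (ExteriorAlgebra ℝ (Eu n))).repr (g y) b) x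
      (EuclideanSpace.single i 1) • Module.finBasis ℝ (ExteriorAlgebra ℝ (Eu n)) b

/-- The coordinate covector `dxⁱ` on `ℝⁿ`. -/
def dx (i : Fin n) : Module.Dual ℝ (Eu n) := (EuclideanSpace.proj i : Eu n →L[ℝ] ℝ)

/-- The Schouten–Nijenhuis bracket of two multivector fields, in coordinates on `ℝⁿ`:
`[P, Q] = ∑ᵢ (P ⌊ dxⁱ) ∧ ∂ᵢQ - ∂ᵢP ∧ (dxⁱ ⌋ Q)`,
where `⌊` and `⌋` are the contractions with a covector from the right and from the left. -/
def schoutenLocal (P Q : Eu n → ExteriorAlgebra ℝ (Eu n)) (x : Eu n) :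
    ExteriorAlgebra ℝ (Eu n) :=
  ∑ i, (CliffordAlgebra.contractRight (P x) (dx n i) * partialDeriv n Q x i
    - partialDeriv n P x i * CliffordAlgebra.contractLeft (dx n i) (Q x))

/-- The Schouten–Nijenhuis bracket of two multivector fields on `M`, computed at each point `p` in
the preferred chart around `p`. -/
def schouten (P Q : MVF n M) : Π p : M, ExteriorAlgebra ℝ (Tan n p) := fun p =>
  ExteriorAlgebra.map (trivInv n p p)
    (schoutenLocal n (localRep n p P.1 ∘ (extChartAt (𝓡 n) p).symm)
      (localRep n p Q.1 ∘ (extChartAt (𝓡 n) p).symm) (extChartAt (𝓡 n) p p))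

/-- The derivative `X(f)` at `p` of a function `f` along a vector field `X`. -/
def dirDeriv (X : VectorField n M) (f : SmoothFun n M) (p : M) : ℝ :=
  mfderiv (𝓡 n) 𝓘(ℝ, ℝ) (f : M → ℝ) p (X p)

variable (M) in
/-- An affine connection on `TM`. -/
@[ext] structure AffineConnection where
  /-- `(X, Y) ↦ ∇_X Y` -/
  toFun : VectorField n M → VectorField n M → VectorField n M
  smul_add_left : ∀ (f : SmoothFun n M) (X X' Y : VectorField n M),
    toFun (funSMul n f X + X') Y = funSMul n f (toFun X Y) + toFun X' Y
  add_right : ∀ X Y Y' : VectorField n M, toFun X (Y + Y') = toFun X Y + toFun X Y'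
  leibniz : ∀ (f : SmoothFun n M) (X Y : VectorField n M) (p : M),
    toFun X (funSMul n f Y) p = dirDeriv n X f p • Y p + f p • toFun X Y p

variable (M) in
/-- A higher affine connection on `M`. -/
@[ext] structure HigherConnection where
  /-- `(X, Y) ↦ ∇_X Y` -/
  toFun : MVF n M → MVF n M → MVF n M
  /-- `∇_X Y ∈ A^{k+l-1}(M)` for `X ∈ Aᵏ(M)`, `Y ∈ Aˡ(M)`. For `k = l = 0`, where
  `A^{-1}(M) = 0`, this is part of `fun_left`. -/
  degree : ∀ (k l m : ℕ) (X Y : MVF n M), k + l = m + 1 → HasDegree n k X → HasDegree n l Y →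
    HasDegree n m (toFun X Y)
  smul_add_left : ∀ (f : SmoothFun n M) (X X' Y : MVF n M),
    toFun (ofFun n f * X + X') Y = ofFun n f * toFun X Y + toFun X' Y
  add_right : ∀ X Y Y' : MVF n M, toFun X (Y + Y') = toFun X Y + toFun X Y'
  apply_fun : ∀ (k : ℕ) (X : MVF n M) (f : SmoothFun n M), HasDegree n k X →
    (toFun X (ofFun n f) : Π p : M, ExteriorAlgebra ℝ (Tan n p)) = schouten n X (ofFun n f)
  leibniz : ∀ (k : ℕ) (X Y : MVF n M) (f : SmoothFun n M), HasDegree n k X →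
    (toFun X (ofFun n f * Y) : Π p : M, ExteriorAlgebra ℝ (Tan n p)) =
      schouten n X (ofFun n f) * Y.1 + (ofFun n f * toFun X Y).1
  fun_left : ∀ (f : SmoothFun n M) (X : MVF n M), toFun (ofFun n f) X = 0

/-- A higher connection is *induced* if it satisfies both product rules
`∇_{X ∧ Y} Z = X ∧ ∇_Y Z + (-1)^{kl} Y ∧ ∇_X Z` and
`∇_X (Y ∧ Z) = ∇_X Y ∧ Z + (-1)^{(k-1)l} Y ∧ ∇_X Z` for `X ∈ Aᵏ(M)`, `Y ∈ Aˡ(M)`, `Z ∈ 𝒜(M)`.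
(The exponent `k - 1` is written `k + 1`, which has the same parity.) -/
def HigherConnection.IsInduced (D : HigherConnection n M) : Prop :=
  ∀ (k l : ℕ) (X Y Z : MVF n M), HasDegree n k X → HasDegree n l Y →
    D.toFun (X * Y) Z = X * D.toFun Y Z + (-1) ^ (k * l) * (Y * D.toFun X Z) ∧
    D.toFun X (Y * Z) = D.toFun X Y * Z + (-1) ^ ((k + 1) * l) * (Y * D.toFun X Z)

/-- `D` is the induced higher connection associated to the affine connection `A`: it is induced and
restricts to `A` on vector fields. -/
def HigherConnection.IsInducedBy (D : HigherConnection n M) (A : AffineConnection n M) : Prop :=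
  D.IsInduced n ∧ ∀ X Y : VectorField n M, D.toFun (ofVF n X) (ofVF n Y) = ofVF n (A.toFun X Y)

variable (M) in
/-- `Γ(E^{k,l})`, the smooth sections of `E^{k,l} = ∧^{k+l-1} TM ⊗ ∧ᵏ T*M ⊗ ∧ˡ T*M` (for `k, l > 0`).
Under the natural isomorphism `∧ᵏ T*_pM ≅ (∧ᵏ T_pM)*`, the fibre of `E^{k,l}` at `p` is the space
of bilinear maps `∧ᵏ T_pM × ∧ˡ T_pM → ∧^{k+l-1} T_pM`. A section is smooth if its components in
the local trivializations are smooth. -/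
@[ext] structure TwistField (k l : ℕ) where
  /-- the value at a point -/
  toFun : Π p : M, ⋀[ℝ]^k (Tan n p) →ₗ[ℝ] ⋀[ℝ]^l (Tan n p) →ₗ[ℝ] ⋀[ℝ]^(k + l - 1) (Tan n p)
  smooth : ∀ (p : M) (a : ⋀[ℝ]^k (Eu n)) (b : ⋀[ℝ]^l (Eu n)),
    SmoothAt n (fun q : M => exteriorPower.map (k + l - 1) (triv n p q)
      (toFun q (exteriorPower.map k (trivInv n p q) a) (exteriorPower.map l (trivInv n p q) b))) p

variable (M) in
/-- The pairs `(A, {F^{k,l}})` of an affine connection `A` on `TM` and a family of sections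
`F^{k,l} ∈ Γ(E^{k,l})`, for `k, l > 0` with `k + l - 1 ≤ n`, such that `F^{1,1} = 0`. -/
@[ext] structure ConnectionData where
  /-- the affine connection -/
  conn : AffineConnection n M
  /-- the sections `F^{k,l}` -/
  twist : ∀ k l : ℕ, 0 < k → 0 < l → k + l - 1 ≤ n → TwistField n M k l
  twist_one_one : ∀ (h : 1 + 1 - 1 ≤ n) (p : M),
    (twist 1 1 one_pos one_pos h).toFun p = 0

/-- `∇_X Y = ∇'_X Y + F^{k,l}(X, Y)` for all `X ∈ Aᵏ(M)` and `Y ∈ Aˡ(M)` with `k, l > 0` and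
`k + l - 1 ≤ n`, where `∇'` is the higher connection induced by the affine connection in the
pair. -/
def Decomposes (D : HigherConnection n M) (S : ConnectionData n M) : Prop :=
  ∃ D' : HigherConnection n M, D'.IsInducedBy n S.conn ∧
    ∀ (k l : ℕ) (hk : 0 < k) (hl : 0 < l) (h : k + l - 1 ≤ n) (X Y : MVF n M)
      (hX : HasDegree n k X) (hY : HasDegree n l Y) (p : M),
      (D.toFun X Y).1 p =
        (D'.toFun X Y).1 p + ((S.twist k l hk hl h).toFun p ⟨X.1 p, hX p⟩ ⟨Y.1 p, hY p⟩).1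

end Manifold

end HigherConn

end

noncomputable section

namespace HigherConn

/-! ### Exterior algebra: signs, right contraction, homogeneous components, derivations. -/

section ExteriorAlgebra

open CliffordAlgebra (contractRight)

variable {V W : Type*} [AddCommGroup V] [Module ℝ V] [AddCommGroup W] [Module ℝ W]

/-! The bracket of `X` with a function `f` is the right contraction of `X` by `df`
(`schouten_ofFun`). Hence the derivative of `f` enters the axioms only through this contraction, and
the Leibniz term of `∇_X (fY)` is the same for all higher connections. Once such terms cancel,
locality does the rest: an additive map that is homogeneous over functions at `q` sees only values
at `q` (`eq_of_evalAt_eq`, by bump functions).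

Induced connections, existence. In a local frame `e_a` with dual coframe `θ^a`, set `∇_X Y = ∑ₐ (X ⌊
θ^a) ∧ ∇_{e_a} Y`, where `∇_{e_a}` extends the affine connection to multivector fields as a
derivation of degree zero (`LocalFrame.evalAt_cov_mul`). The product rule in `X` is the graded
derivation rule of right contraction (`contractRight_mul'`). The product rule in `Y` is the
derivation property, with the sign produced by moving `X ⌊ θ^a` past the first factor.

Induced connections, uniqueness. The difference of two candidates at `q` is tensorial in both
arguments, so it can be tested on products of vector fields, and there the product rules reduce
everything to the affine connection (`IsInducedAt.unique`). Stating this at a single point also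
makes the local constructions agree where they overlap, so they glue.

Classification. The difference of any two higher connections is bilinear over functions
(`HigherConnection.difference_evalAt`). Compare `∇` with the connection induced by its own
restriction to vector fields: the homogeneous components of the difference are the sections
`F^{k,l}`, and `F^{1,1}` vanishes by this choice. Conversely, adding such sections to an induced
connection preserves the axioms. The other bidegrees carry no freedom: `k = 0` and `l = 0` are fixed
by the axioms, and for `k + l - 1 > n` the target is zero. -/

theorem map_mem_exteriorPower (f : V →ₗ[ℝ] W) {k : ℕ} {x : ExteriorAlgebra ℝ V}
    (hx : x ∈ ⋀[ℝ]^k V) : ExteriorAlgebra.map f x ∈ ⋀[ℝ]^k W := by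
  have h : Submodule.map (ExteriorAlgebra.map f).toLinearMap (⋀[ℝ]^k V) ≤ ⋀[ℝ]^k W := by
    unfold ExteriorAlgebra.exteriorPower
    rw [Submodule.map_pow]
    refine pow_le_pow_left' ?_ k
    rintro _ ⟨_, ⟨v, rfl⟩, rfl⟩
    exact ⟨f v, by simp⟩
  exact h ⟨x, hx, rfl⟩

theorem ι_mem_exteriorPower_one (v : V) : ExteriorAlgebra.ι ℝ v ∈ ⋀[ℝ]^1 V := by
  unfold ExteriorAlgebra.exteriorPower
  rw [pow_one]
  exact ⟨v, rfl⟩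

theorem algebraMap_mem_exteriorPower_zero (c : ℝ) :
    algebraMap ℝ (ExteriorAlgebra ℝ V) c ∈ ⋀[ℝ]^0 V := by
  unfold ExteriorAlgebra.exteriorPower
  rw [pow_zero]
  exact Submodule.mem_one.2 ⟨c, rfl⟩

theorem mul_mem_exteriorPower {k l : ℕ} {x y : ExteriorAlgebra ℝ V} (hx : x ∈ ⋀[ℝ]^k V)
    (hy : y ∈ ⋀[ℝ]^l V) : x * y ∈ ⋀[ℝ]^(k + l) V :=
  SetLike.mul_mem_graded hx hy

/-- Induction on homogeneous elements of the exterior algebra, multiplying by a vector on the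
left. -/
theorem exteriorPower_induction {P : ∀ k : ℕ, ∀ x ∈ ⋀[ℝ]^k V, Prop}
    (zero : ∀ c : ℝ, P 0 (algebraMap ℝ _ c) (algebraMap_mem_exteriorPower_zero c))
    (add : ∀ k x y hx hy, P k x hx → P k y hy → P k (x + y) (add_mem hx hy))
    (mul : ∀ (v : V) k x hx, P k x hx → ∀ h, P (k + 1) (ExteriorAlgebra.ι ℝ v * x) h)
    {k : ℕ} {x : ExteriorAlgebra ℝ V} (hx : x ∈ ⋀[ℝ]^k V) : P k x hx := by
  refine Submodule.pow_induction_on_left' (M := LinearMap.range (ExteriorAlgebra.ι ℝ (M := V)))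
    (C := P) zero (fun x y i hx hy h h' => add i x y hx hy h h') ?_ hx
  rintro _ ⟨v, rfl⟩ i x hx h
  exact mul v i x hx h _

/-- Elements of the exterior algebra commute up to sign. -/
theorem ι_mul_comm (v : V) {k : ℕ} {x : ExteriorAlgebra ℝ V} (hx : x ∈ ⋀[ℝ]^k V) :
    x * ExteriorAlgebra.ι ℝ v = (-1) ^ k * (ExteriorAlgebra.ι ℝ v * x) := by
  induction hx using exteriorPower_induction with
  | zero c => simp [Algebra.commutes]
  | add k x y hx hy h h' => simp only [add_mul, mul_add, h, h']
  | mul w k x hx h _ =>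
    have hvw := eq_neg_of_add_eq_zero_left (ExteriorAlgebra.ι_add_mul_swap (R := ℝ) w v)
    rw [mul_assoc, h, ← mul_assoc (ExteriorAlgebra.ι ℝ v), ← neg_eq_iff_eq_neg.2 hvw]
    rcases Nat.even_or_odd k with hk | hk <;>
      simp [hk.neg_one_pow, hk.add_one.neg_one_pow, mul_assoc]

/-- Each of the `l` vector factors of `y` costs `(-1)^k` when moved past `x`. -/
theorem exteriorPower_mul_comm {k l : ℕ} {x y : ExteriorAlgebra ℝ V} (hx : x ∈ ⋀[ℝ]^k V)
    (hy : y ∈ ⋀[ℝ]^l V) : x * y = (-1) ^ (k * l) * (y * x) := by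
  induction hy using exteriorPower_induction with
  | zero c => simp [Algebra.commutes]
  | add l y z hy hz h h' => simp only [add_mul, mul_add, h, h']
  | mul v l y hy h _ =>
    rw [← mul_assoc, ι_mul_comm v hx, mul_assoc, mul_assoc, h]
    rcases Nat.even_or_odd k with hk | hk <;> rcases Nat.even_or_odd (k * l) with hl | hl <;>
      simp [mul_add, pow_add, hk.neg_one_pow, hl.neg_one_pow, mul_assoc]

/-- The exterior algebra is the Clifford algebra of the zero form; this and the three results below
are Clifford facts at `Q = 0`. -/
theorem contractRight_mul_ι (d : Module.Dual ℝ V) (v : V) (x : ExteriorAlgebra ℝ V) :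
    contractRight (x * ExteriorAlgebra.ι ℝ v) d =
      d v • x - contractRight x d * ExteriorAlgebra.ι ℝ v :=
  CliffordAlgebra.contractRight_mul_ι (Q := 0) d v x

theorem contractRight_ι (d : Module.Dual ℝ V) (v : V) :
    contractRight (ExteriorAlgebra.ι ℝ v) d = algebraMap ℝ (ExteriorAlgebra ℝ V) (d v) :=
  CliffordAlgebra.contractRight_ι (Q := 0) d v

theorem contractRight_algebraMap (d : Module.Dual ℝ V) (c : ℝ) :
    contractRight (algebraMap ℝ (ExteriorAlgebra ℝ V) c) d = 0 :=
  CliffordAlgebra.contractRight_algebraMap (Q := 0) d c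

theorem exteriorAlgebra_right_induction {P : ExteriorAlgebra ℝ V → Prop}
    (algebraMap : ∀ c : ℝ, P (algebraMap ℝ _ c)) (add : ∀ x y, P x → P y → P (x + y))
    (mul_ι : ∀ x v, P x → P (x * ExteriorAlgebra.ι ℝ v)) (x : ExteriorAlgebra ℝ V) : P x :=
  CliffordAlgebra.right_induction (Q := 0) algebraMap add (fun v x => mul_ι x v) x

/-- Naturality, used to carry contractions between a tangent space and its coordinate model; the
covector pulls back. -/
theorem contractRight_map (f : V →ₗ[ℝ] W) (d : Module.Dual ℝ W) (x : ExteriorAlgebra ℝ V) :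
    contractRight (ExteriorAlgebra.map f x) d =
      ExteriorAlgebra.map f (contractRight x (d ∘ₗ f)) := by
  induction x using exteriorAlgebra_right_induction with
  | algebraMap c => simp
  | add x y h h' => simp [h, h']
  | mul_ι x v h => simp [contractRight_mul_ι, h]

theorem contractRight_of_mem_zero {x : ExteriorAlgebra ℝ V} (hx : x ∈ ⋀[ℝ]^0 V)
    (d : Module.Dual ℝ V) : contractRight x d = 0 := by
  unfold ExteriorAlgebra.exteriorPower at hx
  rw [pow_zero] at hx
  obtain ⟨c, rfl⟩ := Submodule.mem_one.1 hx
  exact contractRight_algebraMap d c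

/-- The contraction with a covector from the right is a graded derivation. -/
theorem contractRight_mul (d : Module.Dual ℝ V) {l : ℕ} (x : ExteriorAlgebra ℝ V)
    {y : ExteriorAlgebra ℝ V} (hy : y ∈ ⋀[ℝ]^l V) :
    contractRight (x * y) d = x * contractRight y d + (-1) ^ l * (contractRight x d * y) := by
  induction hy using exteriorPower_induction generalizing x with
  | zero c =>
    simp only [ExteriorAlgebra, CliffordAlgebra.contractRight_mul_algebraMap, CliffordAlgebra.contractRight_algebraMap]
    simp
  | add l y z hy hz h h' => simp only [mul_add, map_add, h, h', LinearMap.add_apply]; abel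
  | mul v l y hy h _ =>
    rw [← mul_assoc, h, h, contractRight_mul_ι, contractRight_ι, ← Algebra.smul_def]
    rcases Nat.even_or_odd l with hk | hk <;>
      simp [hk.neg_one_pow, hk.add_one.neg_one_pow, mul_add, sub_mul, mul_assoc] <;> abel

theorem contractRight_mem {k : ℕ} {x : ExteriorAlgebra ℝ V} (hx : x ∈ ⋀[ℝ]^(k + 1) V)
    (d : Module.Dual ℝ V) : contractRight x d ∈ ⋀[ℝ]^k V := by
  -- The degree must be a free variable for the induction, so `k + 1` is replaced by `k` with an
  -- equation.
  suffices h : ∀ {k : ℕ} {x : ExteriorAlgebra ℝ V} (hx : x ∈ ⋀[ℝ]^k V), ∀ l, k = l + 1 →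
      contractRight x d ∈ ⋀[ℝ]^l V from h hx k rfl
  intro k x hx
  induction hx using exteriorPower_induction with
  | zero c => simp
  | add k x y hx hy h h' =>
    intro l hl
    rw [map_add, LinearMap.add_apply]
    exact add_mem (h l hl) (h' l hl)
  | mul v k x hx h _ =>
    rintro l hl
    obtain rfl : k = l := by omega
    rw [contractRight_mul d _ hx, contractRight_ι, ← Algebra.smul_def]
    have hs : ∀ z ∈ ⋀[ℝ]^k V, (-1) ^ k * z ∈ ⋀[ℝ]^k V := fun z hz => by
      rcases Nat.even_or_odd k with hk | hk <;> simpa [hk.neg_one_pow] using hz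
    refine add_mem ?_ (hs _ (Submodule.smul_mem _ _ hx))
    -- A vector times a contracted scalar: the contraction is zero, so no degree `-1` arises.
    cases k with
    | zero => rw [contractRight_of_mem_zero hx, mul_zero]; exact zero_mem _
    | succ k =>
      rw [add_comm]
      exact mul_mem_exteriorPower (ι_mem_exteriorPower_one v) (h k rfl)

theorem ιInv_map (f : V →ₗ[ℝ] W) (x : ExteriorAlgebra ℝ V) :
    ExteriorAlgebra.ιInv (ExteriorAlgebra.map f x) = f (ExteriorAlgebra.ιInv x) :=
  LinearMap.congr_fun (ExteriorAlgebra.ιInv_comp_map f) x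

theorem ι_ιInv {x : ExteriorAlgebra ℝ V} (hx : x ∈ ⋀[ℝ]^1 V) :
    ExteriorAlgebra.ι ℝ (ExteriorAlgebra.ιInv x) = x := by
  unfold ExteriorAlgebra.exteriorPower at hx
  rw [pow_one] at hx
  obtain ⟨v, rfl⟩ := hx
  rw [ExteriorAlgebra.ι_leftInverse]

/-- The homogeneous component of degree `k`. -/
def component (V : Type*) [AddCommGroup V] [Module ℝ V] (k : ℕ) :
    ExteriorAlgebra ℝ V →ₗ[ℝ] ExteriorAlgebra ℝ V :=
  GradedAlgebra.proj (fun i : ℕ => ⋀[ℝ]^i V) k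

theorem component_mem (k : ℕ) (x : ExteriorAlgebra ℝ V) : component V k x ∈ ⋀[ℝ]^k V :=
  SetLike.coe_mem _

theorem component_of_mem {k : ℕ} {x : ExteriorAlgebra ℝ V} (hx : x ∈ ⋀[ℝ]^k V) (l : ℕ) :
    component V l x = if k = l then x else 0 := by
  rw [component, GradedAlgebra.proj_apply,
    DirectSum.decompose_of_mem (fun i : ℕ => ⋀[ℝ]^i V) hx,
    DirectSum.coe_of_apply]
  split_ifs <;> rfl

theorem graded_induction {P : ExteriorAlgebra ℝ V → Prop}
    (homogeneous : ∀ (k : ℕ) (x), x ∈ ⋀[ℝ]^k V → P x) (add : ∀ x y, P x → P y → P (x + y))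
    (x : ExteriorAlgebra ℝ V) : P x := by
  induction x using DirectSum.Decomposition.inductionOn (fun i : ℕ => ⋀[ℝ]^i V) with
  | zero => exact homogeneous 0 0 (zero_mem _)
  | homogeneous m => exact homogeneous _ _ m.2
  | add x y h h' => exact add x y h h'

theorem component_map (f : V →ₗ[ℝ] W) (k : ℕ) (x : ExteriorAlgebra ℝ V) :
    component W k (ExteriorAlgebra.map f x) = ExteriorAlgebra.map f (component V k x) := by
  induction x using graded_induction with
  | homogeneous l x hx =>
    rw [component_of_mem hx, component_of_mem (map_mem_exteriorPower f hx)]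
    split_ifs <;> simp
  | add x y h h' => simp only [map_add, h, h']

theorem exteriorPower_eq_zero [Module.Finite ℝ V] {k : ℕ} (hk : Module.finrank ℝ V < k)
    {x : ExteriorAlgebra ℝ V} (hx : x ∈ ⋀[ℝ]^k V) : x = 0 := by
  have h : Module.finrank ℝ (⋀[ℝ]^k V) = 0 := by
    rw [exteriorPower.finrank_eq, Nat.choose_eq_zero_of_lt hk]
  rwa [Submodule.finrank_eq_zero.mp h] at hx

theorem sum_component [Module.Finite ℝ V] (x : ExteriorAlgebra ℝ V) :
    ∑ k ∈ Finset.range (Module.finrank ℝ V + 1), component V k x = x := by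
  induction x using graded_induction with
  | homogeneous l x hx =>
    simp only [component_of_mem hx, Finset.sum_ite_eq]
    split_ifs with h
    · rfl
    · exact (exteriorPower_eq_zero (by simpa using h) hx).symm
  | add x y h h' => simp only [map_add, Finset.sum_add_distrib, h, h']

/-- Given an algebra map `φ` out of an exterior algebra, a linear map `g` on vectors which is
anti-commutative with `φ` extends to a derivation along `φ`. -/
theorem exists_derivation {R : Type*} [Ring R] [Algebra ℝ R] (φ : ExteriorAlgebra ℝ V →ₐ[ℝ] R)
    (g : V →ₗ[ℝ] R)
    (hg : ∀ v, φ (ExteriorAlgebra.ι ℝ v) * g v + g v * φ (ExteriorAlgebra.ι ℝ v) = 0) :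
    ∃ ψ : ExteriorAlgebra ℝ V →ₗ[ℝ] R, (∀ v, ψ (ExteriorAlgebra.ι ℝ v) = g v) ∧
      ∀ x y, ψ (x * y) = ψ x * φ y + φ x * ψ y := by
  -- Dual numbers: an algebra map `φ + εψ` is the same as a derivation `ψ` along `φ`. The hypothesis
  -- `hg` is what makes `φ + εg` square to zero on vectors, so the universal property applies.
  let L : V →ₗ[ℝ] TrivSqZeroExt R R :=
    { toFun := fun v => (φ (ExteriorAlgebra.ι ℝ v), g v)
      map_add' := fun v w => by rw [map_add, map_add, map_add]; rfl
      map_smul' := fun c v => by rw [map_smul, map_smul, map_smul]; rfl }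
  have hL : ∀ v, L v * L v = 0 := fun v => by
    ext
    · change φ _ * φ _ = 0
      rw [← map_mul, ExteriorAlgebra.ι_sq_zero, map_zero]
    · exact hg v
  let Ψ := ExteriorAlgebra.lift ℝ ⟨L, hL⟩
  have hι : ∀ v, Ψ (ExteriorAlgebra.ι ℝ v) = L v := ExteriorAlgebra.lift_ι_apply ℝ L hL
  have hfst : ∀ x, (Ψ x).fst = φ x := by
    intro x
    have : (TrivSqZeroExt.fstHom ℝ R R).comp Ψ = φ := by
      refine ExteriorAlgebra.hom_ext (LinearMap.ext fun v => ?_)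
      change (Ψ (ExteriorAlgebra.ι ℝ v)).fst = _
      rw [hι]
      rfl
    exact DFunLike.congr_fun this x
  refine ⟨⟨⟨fun x => (Ψ x).snd, fun x y => by rw [map_add, TrivSqZeroExt.snd_add]⟩,
    fun c x => by
      change (Ψ (c • x)).snd = c • (Ψ x).snd
      rw [map_smul, TrivSqZeroExt.snd_smul]⟩, fun v => ?_, fun x y => ?_⟩
  · change (Ψ (ExteriorAlgebra.ι ℝ v)).snd = _
    rw [hι]
    rfl
  · change (Ψ (x * y)).snd = (Ψ x).snd * _ + _ * (Ψ y).snd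
    rw [map_mul, TrivSqZeroExt.snd_mul, hfst, hfst, add_comm, smul_eq_mul, MulOpposite.smul_eq_mul_unop]
    rfl

end ExteriorAlgebra

/-! ### Smoothness tested by linear functionals. -/

section SmoothAt

variable {n : ℕ} {M : Type*} [TopologicalSpace M] [ChartedSpace (Eu n) M]
  {W W' : Type*} [AddCommGroup W] [Module ℝ W] [AddCommGroup W'] [Module ℝ W'] {p : M}

open Filter Topology

theorem SmoothAt.congr {g h : M → W} (hg : SmoothAt n g p) (e : h =ᶠ[𝓝 p] g) :
    SmoothAt n h p := fun ξ =>
  (hg ξ).congr_of_eventuallyEq (e.mono fun q hq => by simp [hq])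

theorem SmoothAt.const (w : W) : SmoothAt n (fun _ : M => w) p := fun _ => contMDiffAt_const

theorem SmoothAt.add {g h : M → W} (hg : SmoothAt n g p) (hh : SmoothAt n h p) :
    SmoothAt n (fun q => g q + h q) p := fun ξ => by
  simpa only [map_add] using! (hg ξ).add (hh ξ)

theorem SmoothAt.smul {f : M → ℝ} {g : M → W} (hf : ContMDiffAt (𝓡 n) 𝓘(ℝ, ℝ) ∞ f p)
    (hg : SmoothAt n g p) : SmoothAt n (fun q => f q • g q) p := fun ξ => by
  simpa only [map_smul, smul_eq_mul] using! hf.mul (hg ξ)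

theorem SmoothAt.sum {ι : Type*} {s : Finset ι} {g : ι → M → W}
    (hg : ∀ i ∈ s, SmoothAt n (g i) p) : SmoothAt n (fun q => ∑ i ∈ s, g i q) p := fun ξ => by
  simpa only [map_sum] using! ContMDiffAt.sum fun i hi => hg i hi ξ

theorem SmoothAt.linear {g : M → W} (hg : SmoothAt n g p) (L : W →ₗ[ℝ] W') :
    SmoothAt n (fun q => L (g q)) p := fun ξ => hg (ξ ∘ₗ L)

theorem SmoothAt.of_linear_injective {g : M → W} (L : W →ₗ[ℝ] W')
    (hL : Function.Injective L) (hg : SmoothAt n (fun q => L (g q)) p) : SmoothAt n g p := by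
  obtain ⟨K, hK⟩ := L.exists_leftInverse_of_injective (LinearMap.ker_eq_bot.2 hL)
  refine (hg.linear K).congr (Eventually.of_forall fun q => ?_)
  exact (LinearMap.congr_fun hK (g q)).symm

/-- A smooth family of linear maps applied to a smooth map is smooth. -/
theorem SmoothAt.apply [Module.Finite ℝ W] {L : M → W →ₗ[ℝ] W'} {g : M → W}
    (hL : ∀ w, SmoothAt n (fun q => L q w) p) (hg : SmoothAt n g p) :
    SmoothAt n (fun q => L q (g q)) p := by
  let B := Module.finBasis ℝ W
  have h : (fun q => L q (g q)) = fun q => ∑ i, B.coord i (g q) • L q (B i) := by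
    funext q
    conv_lhs => rw [← B.sum_repr (g q)]
    simp only [map_sum, map_smul, Module.Basis.coord_apply]
  rw [h]
  exact SmoothAt.sum fun i _ => SmoothAt.smul (hg (B.coord i)) (hL (B i))

theorem ContMDiffAt.smoothAt {F : Type*} [NormedAddCommGroup F] [NormedSpace ℝ F]
    [FiniteDimensional ℝ F] {g : M → F} (hg : ContMDiffAt (𝓡 n) 𝓘(ℝ, F) ∞ g p) :
    SmoothAt n g p := fun ξ =>
  (LinearMap.toContinuousLinearMap ξ).contMDiff.contMDiffAt.comp p hg

theorem SmoothAt.contMDiffAt {g : M → Eu n} (hg : SmoothAt n g p) :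
    ContMDiffAt (𝓡 n) 𝓘(ℝ, Eu n) ∞ g p := by
  have h : ContMDiffAt (𝓡 n) 𝓘(ℝ, Fin n → ℝ) ∞ (fun q => EuclideanSpace.equiv (Fin n) ℝ (g q)) p :=
    contMDiffAt_pi_space.2 fun i => hg (dx n i)
  exact (EuclideanSpace.equiv (Fin n) ℝ).symm.contDiff.contMDiff.contMDiffAt.comp p h

/-- By `SmoothAt.apply` a constant argument suffices, and constants are generated by vectors under
sums and products, which preserve smoothness. -/
theorem SmoothAt.exteriorAlgebra_map {L : M → Eu n →ₗ[ℝ] Eu n}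
    {g : M → ExteriorAlgebra ℝ (Eu n)} (hL : ∀ v, SmoothAt n (fun q => L q v) p)
    (hg : SmoothAt n g p) : SmoothAt n (fun q => ExteriorAlgebra.map (L q) (g q)) p := by
  refine SmoothAt.apply (L := fun q => (ExteriorAlgebra.map (L q)).toLinearMap) (fun w => ?_) hg
  induction w using ExteriorAlgebra.induction with
  | algebraMap c => simpa using SmoothAt.const _
  | ι v => simpa using (hL v).linear (ExteriorAlgebra.ι ℝ)
  | mul x y hx hy => simpa using hx.mul hy
  | add x y hx hy => simpa using hx.add hy

theorem chart_source_mem_nhds {q : M} (h : q ∈ (chartAt (Eu n) p).source) :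
    (chartAt (Eu n) p).source ∈ 𝓝 q :=
  (chartAt (Eu n) p).open_source.mem_nhds h

theorem mdifferentiableAt (f : SmoothFun n M) (q : M) :
    MDifferentiableAt (𝓡 n) 𝓘(ℝ, ℝ) (f : M → ℝ) q :=
  f.contMDiff.mdifferentiable (by simp) q

end SmoothAt

/-! ### Local trivializations, differentials, and the bracket with a function. -/

section Trivialization

variable {n : ℕ} {M : Type*} [TopologicalSpace M] [ChartedSpace (Eu n) M]
  [IsManifold (𝓡 n) ∞ M] {p q : M}

open Filter Topology

theorem triv_trivInv (hq : q ∈ (chartAt (Eu n) p).source) (v : Eu n) :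
    triv n p q (trivInv n p q v) = v :=
  Bundle.Trivialization.continuousLinearMapAt_symmL _ (R := ℝ) (b := q) hq v

theorem trivInv_triv (hq : q ∈ (chartAt (Eu n) p).source) (v : Tan n q) :
    trivInv n p q (triv n p q v) = v :=
  Bundle.Trivialization.symmL_continuousLinearMapAt _ (R := ℝ) (b := q) hq v

theorem map_triv_map_trivInv (hq : q ∈ (chartAt (Eu n) p).source) (x : ExteriorAlgebra ℝ (Eu n)) :
    ExteriorAlgebra.map (triv n p q) (ExteriorAlgebra.map (trivInv n p q) x) = x := by
  have h : triv n p q ∘ₗ trivInv n p q = LinearMap.id := LinearMap.ext (triv_trivInv hq)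
  rw [← AlgHom.comp_apply, ExteriorAlgebra.map_comp_map, h, ExteriorAlgebra.map_id,
    AlgHom.id_apply]

theorem map_trivInv_map_triv (hq : q ∈ (chartAt (Eu n) p).source) (x : ExteriorAlgebra ℝ (Tan n q)) :
    ExteriorAlgebra.map (trivInv n p q) (ExteriorAlgebra.map (triv n p q) x) = x := by
  have h : trivInv n p q ∘ₗ triv n p q = LinearMap.id := LinearMap.ext (trivInv_triv hq)
  rw [← AlgHom.comp_apply, ExteriorAlgebra.map_comp_map, h, ExteriorAlgebra.map_id,
    AlgHom.id_apply]

/-- The tangent space at `p` is modelled through the preferred chart at `p`, so at its own centre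
that chart's transition map is the identity. -/
theorem triv_self (v : Tan n p) : triv n p p v = v := by
  have h := TangentBundle.continuousLinearMapAt_trivializationAt_eq_core (I := 𝓡 n) (b₀ := p)
    (b := p) (mem_chart_source _ _)
  change (trivializationAt (Eu n) (TangentSpace (𝓡 n) : M → Type) p).continuousLinearMapAt ℝ p v = v
  rw [h]
  exact (tangentBundleCore (𝓡 n) M).coordChange_self _ _ (mem_chart_source _ _) _

theorem trivInv_self (v : Eu n) : trivInv n p p v = v := by
  have h := triv_trivInv (mem_chart_source (Eu n) p) v
  exact (triv_self (trivInv n p p v)).symm.trans h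

theorem smoothAt_triv_trivInv {p₁ p₂ : M} (h₁ : q ∈ (chartAt (Eu n) p₁).source)
    (h₂ : q ∈ (chartAt (Eu n) p₂).source) (v : Eu n) :
    SmoothAt n (fun r => triv n p₂ r (trivInv n p₁ r v)) q := by
  let e₁ := trivializationAt (Eu n) (TangentSpace (𝓡 n) : M → Type) p₁
  let e₂ := trivializationAt (Eu n) (TangentSpace (𝓡 n) : M → Type) p₂
  have hs : e₁.baseSet ∩ e₂.baseSet ∈ 𝓝 q :=
    (e₁.open_baseSet.inter e₂.open_baseSet).mem_nhds ⟨h₁, h₂⟩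
  have h := (contMDiffOn_coordChangeL (IB := 𝓡 n) (n := ∞) e₁ e₂).contMDiffAt hs
  have h' : ContMDiffAt (𝓡 n) 𝓘(ℝ, Eu n) ∞
      (fun r => (e₁.coordChangeL ℝ e₂ r : Eu n →L[ℝ] Eu n) v) q :=
    h.clm_apply contMDiffAt_const
  refine (ContMDiffAt.smoothAt h').congr ?_
  filter_upwards [hs] with r hr
  rw [ContinuousLinearEquiv.coe_coe, Bundle.Trivialization.coordChangeL_apply _ _ hr]
  change e₂.continuousLinearMapAt ℝ r (e₁.symmL ℝ r v) = _
  rw [Bundle.Trivialization.continuousLinearMapAt_apply_of_mem (R := ℝ) _ hr.2,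
    Bundle.Trivialization.symmL_apply _ hr.1]

theorem localRep_change {p₁ p₂ : M} (h₁ : q ∈ (chartAt (Eu n) p₁).source)
    (X : Π q : M, ExteriorAlgebra ℝ (Tan n q)) :
    localRep n p₂ X q =
      ExteriorAlgebra.map (triv n p₂ q ∘ₗ trivInv n p₁ q) (localRep n p₁ X q) := by
  rw [← ExteriorAlgebra.map_comp_map, AlgHom.comp_apply, localRep, localRep,
    map_trivInv_map_triv h₁]

/-- Smooth sections are defined by each chart at its centre only; this spreads smoothness over the
whole chart domain. -/
theorem smoothAt_localRep_change {p₁ p₂ : M} (h₁ : q ∈ (chartAt (Eu n) p₁).source)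
    (h₂ : q ∈ (chartAt (Eu n) p₂).source) {X : Π q : M, ExteriorAlgebra ℝ (Tan n q)}
    (hX : SmoothAt n (localRep n p₁ X) q) : SmoothAt n (localRep n p₂ X) q := by
  refine (hX.exteriorAlgebra_map (L := fun r => triv n p₂ r ∘ₗ trivInv n p₁ r)
    (smoothAt_triv_trivInv h₁ h₂)).congr ?_
  filter_upwards [chart_source_mem_nhds h₁] with r hr
  exact localRep_change hr X

theorem smoothAt_localRep (X : MVF n M) (h : q ∈ (chartAt (Eu n) p).source) :
    SmoothAt n (localRep n p X.1) q :=
  smoothAt_localRep_change (mem_chart_source _ q) h (X.2 q)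

/-- Smoothness is local; this is the gluing criterion for the induced connection. -/
theorem isSmoothSection_of_eventuallyEq {X : Π q : M, ExteriorAlgebra ℝ (Tan n q)}
    (h : ∀ p, ∃ Y : MVF n M, ∀ᶠ q in 𝓝 p, X q = Y.1 q) : IsSmoothSection n X := fun p => by
  obtain ⟨Y, hY⟩ := h p
  exact (Y.2 p).congr (hY.mono fun q hq => by simp only [localRep, hq])

theorem contMDiffAt_section_of_smoothAt {V : Π q : M, Tan n q}
    (hV : SmoothAt n (fun q => triv n p q (V q)) p) :
    ContMDiffAt (𝓡 n) ((𝓡 n).prod 𝓘(ℝ, Eu n)) ∞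
      (fun q => Bundle.TotalSpace.mk' (Eu n) (E := (TangentSpace (𝓡 n) : M → Type)) q (V q)) p := by
  rw [Bundle.contMDiffAt_section]
  refine hV.contMDiffAt.congr_of_eventuallyEq ?_
  filter_upwards [chart_source_mem_nhds (mem_chart_source (Eu n) p)] with r hr
  change _ = (trivializationAt (Eu n) (TangentSpace (𝓡 n) : M → Type) p).continuousLinearMapAt ℝ r
    (V r)
  rw [Bundle.Trivialization.continuousLinearMapAt_apply_of_mem (R := ℝ) _ hr]

/-- The differential of a smooth function. -/
def differential (f : SmoothFun n M) (q : M) : Module.Dual ℝ (Tan n q) :=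
  { toFun := fun v => mfderiv (𝓡 n) 𝓘(ℝ, ℝ) (f : M → ℝ) q v
    map_add' := fun v w => map_add (mfderiv (𝓡 n) 𝓘(ℝ, ℝ) (f : M → ℝ) q) v w
    map_smul' := fun c v => map_smul (mfderiv (𝓡 n) 𝓘(ℝ, ℝ) (f : M → ℝ) q) c v }

theorem dirDeriv_eq (X : VectorField n M) (f : SmoothFun n M) (q : M) :
    dirDeriv n X f q = differential f q (X q) := rfl

theorem fderiv_comp_extChartAt_symm (f : SmoothFun n M) (q : M) (v : Eu n) :
    fderiv ℝ (fun y => f ((extChartAt (𝓡 n) q).symm y)) (extChartAt (𝓡 n) q q) v =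
      differential f q (trivInv n q q v) := by
  rw [show differential f q (trivInv n q q v) = differential f q v from
    congrArg (differential f q) (trivInv_self v)]
  have h := (mdifferentiableAt f q).mfderiv
  rw [ModelWithCorners.range_eq_univ, fderivWithin_univ] at h
  exact (DFunLike.congr_fun h v).symm

theorem partialDeriv_algebraMap (g : Eu n → ℝ) (x : Eu n) (i : Fin n) :
    partialDeriv n (fun y => algebraMap ℝ (ExteriorAlgebra ℝ (Eu n)) (g y)) x i =
      algebraMap ℝ _ (fderiv ℝ g x (EuclideanSpace.single i 1)) := by
  let B := Module.finBasis ℝ (ExteriorAlgebra ℝ (Eu n))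
  have h : ∀ b, fderiv ℝ (fun y => B.repr (algebraMap ℝ (ExteriorAlgebra ℝ (Eu n)) (g y)) b) x
      (EuclideanSpace.single i 1) = fderiv ℝ g x (EuclideanSpace.single i 1) * B.repr 1 b := by
    intro b
    have e : (fun y => B.repr (algebraMap ℝ (ExteriorAlgebra ℝ (Eu n)) (g y)) b) =
        fun y => B.repr 1 b • g y := by
      funext y
      rw [Algebra.algebraMap_eq_smul_one, map_smul, Finsupp.smul_apply, smul_eq_mul, smul_eq_mul,
        mul_comm]
    rw [e, show (fun y => B.repr 1 b • g y) = B.repr 1 b • g from rfl, fderiv_const_smul_field]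
    simp [mul_comm]
  change ∑ b, fderiv ℝ (fun y => B.repr (algebraMap ℝ (ExteriorAlgebra ℝ (Eu n)) (g y)) b) x
      (EuclideanSpace.single i 1) • B b = _
  simp only [h, mul_smul]
  rw [← Finset.smul_sum, B.sum_repr, ← Algebra.algebraMap_eq_smul_one]

theorem sum_smul_dx (d : Module.Dual ℝ (Eu n)) :
    ∑ i, d (EuclideanSpace.single i 1) • dx n i = d := by
  refine LinearMap.ext fun v => ?_
  have hv : v = ∑ i, v i • EuclideanSpace.single i (1 : ℝ) := by
    ext j
    simp [Pi.single_apply]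
  conv_rhs => rw [hv]
  simp [dx, mul_comm, LinearMap.sum_apply]

/-- The Schouten bracket with a function is the contraction with its differential. -/
theorem schouten_ofFun (X : MVF n M) (f : SmoothFun n M) (q : M) :
    schouten n X (ofFun n f) q = CliffordAlgebra.contractRight (X.1 q) (differential f q) := by
  have hq := mem_chart_source (Eu n) q
  have hf : localRep n q (ofFun n f).1 ∘ (extChartAt (𝓡 n) q).symm =
      fun y => algebraMap ℝ _ (f ((extChartAt (𝓡 n) q).symm y)) := by
    funext y
    simp [localRep, ofFun]
  have hX : (localRep n q X.1 ∘ (extChartAt (𝓡 n) q).symm) (extChartAt (𝓡 n) q q) =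
      ExteriorAlgebra.map (triv n q q) (X.1 q) := by
    simp only [Function.comp_apply, extChartAt_to_inv]
    rfl
  -- A scalar has zero left contraction, so the second half of the bracket disappears.
  have h0 : ∀ c i, CliffordAlgebra.contractLeft (Q := (0 : QuadraticForm ℝ (Eu n))) (dx n i)
      (algebraMap ℝ (ExteriorAlgebra ℝ (Eu n)) c) = 0 := fun c i =>
    CliffordAlgebra.contractLeft_algebraMap (Q := 0) (dx n i) c
  unfold schouten schoutenLocal
  rw [hf, hX]
  simp only [h0, mul_zero, sub_zero, partialDeriv_algebraMap, fderiv_comp_extChartAt_symm]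
  -- The partial derivatives reassemble into the single covector `df`, read in the chart.
  have e : ∑ i, CliffordAlgebra.contractRight (ExteriorAlgebra.map (triv n q q) (X.1 q)) (dx n i) *
      algebraMap ℝ _ ((differential f q ∘ₗ trivInv n q q) (EuclideanSpace.single i 1 : Eu n)) =
      CliffordAlgebra.contractRight (ExteriorAlgebra.map (triv n q q) (X.1 q))
        (differential f q ∘ₗ trivInv n q q) := by
    conv_rhs => rw [← sum_smul_dx (differential f q ∘ₗ trivInv n q q)]
    simp only [map_sum, map_smul, ← Algebra.commutes, ← Algebra.smul_def]
  refine (congrArg (ExteriorAlgebra.map (trivInv n q q)) e).trans ?_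
  rw [contractRight_map, map_trivInv_map_triv hq]
  congr 1
  exact LinearMap.ext fun v => congrArg (differential f q) (trivInv_triv hq v)

theorem contMDiff_dirDeriv (X : VectorField n M) (f : SmoothFun n M) :
    ContMDiff (𝓡 n) 𝓘(ℝ, ℝ) ∞ (dirDeriv n X f) := by
  have h : ContMDiff (𝓡 n) 𝓘(ℝ, ℝ).tangent ∞
      (fun q => tangentMap (𝓡 n) 𝓘(ℝ, ℝ) (f : M → ℝ)
        (Bundle.TotalSpace.mk' (Eu n) (E := (TangentSpace (𝓡 n) : M → Type)) q (X q))) :=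
    (f.contMDiff.contMDiff_tangentMap (by simp)).comp X.contMDiff
  exact (contMDiff_snd_tangentBundle_modelSpace (H := ℝ) (I := 𝓘(ℝ, ℝ))).comp h

variable (n) in
/-- The derivative of a function along a vector field, as a smooth function. -/
def dirDerivFun (X : VectorField n M) (f : SmoothFun n M) : SmoothFun n M :=
  ⟨dirDeriv n X f, contMDiff_dirDeriv X f⟩

end Trivialization

/-! ### Multivector fields at a point, functions and vector fields among them. -/

section Sections

variable {n : ℕ} {M : Type*} [TopologicalSpace M] [ChartedSpace (Eu n) M]
  [IsManifold (𝓡 n) ∞ M] {p q : M}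

open Filter Topology

@[ext] theorem MVF.ext {X Y : MVF n M} (h : ∀ q, X.1 q = Y.1 q) : X = Y :=
  Subtype.ext (funext h)

/-- Evaluation of multivector fields at a point. -/
def evalAt (n : ℕ) {M : Type*} [TopologicalSpace M] [ChartedSpace (Eu n) M]
    [IsManifold (𝓡 n) ∞ M] (q : M) : MVF n M →ₐ[ℝ] ExteriorAlgebra ℝ (Tan n q) :=
  (Pi.evalAlgHom ℝ (fun q : M => ExteriorAlgebra ℝ (Tan n q)) q).comp (MVF n M).val

theorem evalAt_apply (X : MVF n M) : evalAt n q X = X.1 q := rfl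

theorem evalAt_ofFun (f : SmoothFun n M) :
    evalAt n q (ofFun n f) = algebraMap ℝ _ (f q) := rfl

theorem evalAt_ofVF (V : VectorField n M) :
    evalAt n q (ofVF n V) = ExteriorAlgebra.ι ℝ (V q) := rfl

theorem evalAt_ofFun_mul (f : SmoothFun n M) (X : MVF n M) :
    evalAt n q (ofFun n f * X) = f q • evalAt n q X := by
  rw [map_mul, evalAt_ofFun, Algebra.smul_def]

theorem HasDegree.mul {k l : ℕ} {X Y : MVF n M} (hX : HasDegree n k X) (hY : HasDegree n l Y) :
    HasDegree n (k + l) (X * Y) := fun q => mul_mem_exteriorPower (hX q) (hY q)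

theorem HasDegree.add {k : ℕ} {X Y : MVF n M} (hX : HasDegree n k X) (hY : HasDegree n k Y) :
    HasDegree n k (X + Y) := fun q => add_mem (hX q) (hY q)

theorem hasDegree_ofFun (f : SmoothFun n M) : HasDegree n 0 (ofFun n f) := fun _ =>
  algebraMap_mem_exteriorPower_zero _

theorem hasDegree_ofVF (V : VectorField n M) : HasDegree n 1 (ofVF n V) := fun _ =>
  ι_mem_exteriorPower_one _

theorem ofFun_one_mul (X : MVF n M) : ofFun n 1 * X = X := by
  ext q
  rw [← evalAt_apply, evalAt_ofFun_mul]
  exact one_smul _ _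

/-- Vector fields as multivector fields, linearly. -/
def ofVFHom (n : ℕ) (M : Type*) [TopologicalSpace M] [ChartedSpace (Eu n) M]
    [IsManifold (𝓡 n) ∞ M] : VectorField n M →ₗ[ℝ] MVF n M where
  toFun := ofVF n
  map_add' V W := by
    ext q
    exact map_add (ExteriorAlgebra.ι ℝ) (V q) (W q)
  map_smul' c V := by
    ext q
    exact map_smul (ExteriorAlgebra.ι ℝ) c (V q)

/-- The vector field underlying the component of degree one. -/
def toVF (X : MVF n M) : VectorField n M :=
  ⟨fun q => ExteriorAlgebra.ιInv (X.1 q), fun p => by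
    refine contMDiffAt_section_of_smoothAt ?_
    refine ((X.2 p).linear ExteriorAlgebra.ιInv).congr (Eventually.of_forall fun r => ?_)
    exact (ιInv_map _ _).symm⟩

theorem toVF_apply (X : MVF n M) : toVF X q = ExteriorAlgebra.ιInv (evalAt n q X) := rfl

theorem toVF_ofVF (V : VectorField n M) : toVF (ofVF n V) = V := by
  ext q
  exact ExteriorAlgebra.ι_leftInverse (V q)

theorem ofVF_toVF {X : MVF n M} (hX : HasDegree n 1 X) : ofVF n (toVF X) = X := by
  ext q
  exact ι_ιInv (hX q)

theorem toVF_add (X Y : MVF n M) : toVF (X + Y) = toVF X + toVF Y := by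
  ext q
  exact map_add ExteriorAlgebra.ιInv (evalAt n q X) (evalAt n q Y)

theorem toVF_ofFun_mul (f : SmoothFun n M) (X : MVF n M) :
    toVF (ofFun n f * X) = funSMul n f (toVF X) := by
  ext q
  rw [toVF_apply, evalAt_ofFun_mul, map_smul]
  rfl

theorem ofVF_injective {V W : VectorField n M} (h : ofVF n V = ofVF n W) : V = W := by
  rw [← toVF_ofVF V, h, toVF_ofVF]

theorem ofVF_funSMul (f : SmoothFun n M) (V : VectorField n M) :
    ofVF n (funSMul n f V) = ofFun n f * ofVF n V := by
  ext q
  rw [← evalAt_apply (ofFun n f * ofVF n V), evalAt_ofFun_mul]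
  exact map_smul (ExteriorAlgebra.ι ℝ) (f q) (V q)

end Sections

/-! ### Bump functions. -/

section Bump

variable {n : ℕ} {M : Type*} [TopologicalSpace M] [ChartedSpace (Eu n) M]
  [IsManifold (𝓡 n) ∞ M] {W : Type*} [AddCommGroup W] [Module ℝ W] {p q : M}

open Filter Topology

/-- Outside the chart domain the bump function vanishes near `q`, so `g` matters only inside it. -/
theorem smoothAt_bump_smul [T2Space M] (χ : SmoothBumpFunction (𝓡 n) p) {g : M → W}
    (hg : q ∈ (chartAt (Eu n) p).source → SmoothAt n g q) :
    SmoothAt n (fun r => χ r • g r) q := by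
  by_cases hq : q ∈ (chartAt (Eu n) p).source
  · exact SmoothAt.smul χ.contMDiffAt (hg hq)
  · have h : q ∉ tsupport χ := fun h => hq (χ.tsupport_subset_chartAt_source h)
    refine (SmoothAt.const (0 : W)).congr ?_
    filter_upwards [notMem_tsupport_iff_eventuallyEq.1 h] with r hr
    rw [hr]
    exact zero_smul _ _

/-- A smooth function which is `1` near `p` and is supported in a given neighbourhood. -/
theorem exists_bump [T2Space M] {s : Set M} (hs : s ∈ 𝓝 p) :
    ∃ f : SmoothFun n M, f p = 1 ∧ ∀ r ∉ s, f r = 0 := by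
  obtain ⟨χ, -, hχ⟩ := (SmoothBumpFunction.nhds_basis_support (I := 𝓡 n) hs).mem_iff.1 hs
  refine ⟨⟨χ, χ.contMDiff⟩, χ.eq_one, fun r hr => ?_⟩
  by_contra h
  exact hr (hχ h)

end Bump

/-! ### Local frames extended to all of `M`, and tensoriality. -/

section Frame

variable {n : ℕ} {M : Type*} [TopologicalSpace M] [ChartedSpace (Eu n) M]
  [IsManifold (𝓡 n) ∞ M] {p q : M}

open Filter Topology

/-- Global vector fields and functions which, near `p`, are the coordinate frame of the preferred
chart around `p` and the coefficients of multivector fields in this chart. -/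
structure LocalFrame (n : ℕ) {M : Type*} [TopologicalSpace M] [ChartedSpace (Eu n) M]
    [IsManifold (𝓡 n) ∞ M] (p : M) where
  /-- the neighbourhood -/
  nhd : Set M
  isOpen : IsOpen nhd
  mem : p ∈ nhd
  subset : nhd ⊆ (chartAt (Eu n) p).source
  /-- the frame -/
  vec : Eu n →ₗ[ℝ] VectorField n M
  vec_eq : ∀ q ∈ nhd, ∀ v, vec v q = trivInv n p q v
  /-- the coefficients -/
  coef : Module.Dual ℝ (ExteriorAlgebra ℝ (Eu n)) → MVF n M → SmoothFun n M
  coef_eq : ∀ q ∈ nhd, ∀ ξ X, coef ξ X q = ξ (localRep n p X.1 q)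

/-- Multiply the coordinate frame and the coefficient functions by a bump function equal to `1` near
`p`. -/
theorem nonempty_localFrame [T2Space M] (p : M) : Nonempty (LocalFrame n p) := by
  let χ : SmoothBumpFunction (𝓡 n) p := Classical.arbitrary _
  obtain ⟨U, hU, hUo, hpU⟩ := eventually_nhds_iff.1 χ.eventuallyEq_one
  refine ⟨⟨U ∩ (chartAt (Eu n) p).source, hUo.inter (chartAt (Eu n) p).open_source,
    ⟨hpU, mem_chart_source _ p⟩, Set.inter_subset_right,
    ⟨⟨fun v => ⟨fun q => χ q • trivInv n p q v, fun q => ?_⟩, ?_⟩, ?_⟩, ?_,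
    fun ξ X => ⟨fun q => χ q • ξ (localRep n p X.1 q), fun q => ?_⟩, ?_⟩⟩
  · refine contMDiffAt_section_of_smoothAt ?_
    simp only [map_smul]
    exact smoothAt_bump_smul χ fun h => smoothAt_triv_trivInv h (mem_chart_source _ q) v
  · intro v w
    ext q
    change χ q • trivInv n p q (v + w) = χ q • trivInv n p q v + χ q • trivInv n p q w
    rw [map_add, smul_add]
  · intro c v
    ext q
    change χ q • trivInv n p q (c • v) = c • χ q • trivInv n p q v
    rw [map_smul, smul_comm]
  · intro q hq v
    change χ q • trivInv n p q v = _
    rw [hU q hq.1]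
    exact one_smul _ _
  · exact smoothAt_bump_smul χ (fun h => (smoothAt_localRep X h).linear ξ) LinearMap.id
  · intro q hq ξ X
    change χ q • ξ (localRep n p X.1 q) = _
    rw [hU q hq.1]
    exact one_smul _ _

namespace LocalFrame

variable (E : LocalFrame n p)

theorem eventually_mem : ∀ᶠ q in 𝓝 p, q ∈ E.nhd := E.isOpen.mem_nhds E.mem

/-- The constant multivector fields in the frame. -/
def const : ExteriorAlgebra ℝ (Eu n) →ₐ[ℝ] MVF n M :=
  ExteriorAlgebra.lift ℝ ⟨ofVFHom n M ∘ₗ E.vec, fun v => by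
    ext q
    exact ExteriorAlgebra.ι_sq_zero (E.vec v q)⟩

theorem const_ι (v : Eu n) : E.const (ExteriorAlgebra.ι ℝ v) = ofVF n (E.vec v) :=
  ExteriorAlgebra.lift_ι_apply ℝ (ofVFHom n M ∘ₗ E.vec) _ v

theorem evalAt_const (hq : q ∈ E.nhd) (b : ExteriorAlgebra ℝ (Eu n)) :
    evalAt n q (E.const b) = ExteriorAlgebra.map (trivInv n p q) b := by
  have h : (evalAt n q).comp E.const = ExteriorAlgebra.map (trivInv n p q) := by
    refine ExteriorAlgebra.hom_ext (LinearMap.ext fun v => ?_)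
    change evalAt n q (E.const (ExteriorAlgebra.ι ℝ v)) =
      ExteriorAlgebra.map (trivInv n p q) (ExteriorAlgebra.ι ℝ v)
    rw [const_ι, evalAt_ofVF, E.vec_eq q hq, ExteriorAlgebra.map_apply_ι]
  exact DFunLike.congr_fun h b

theorem hasDegree_const {k : ℕ} {b : ExteriorAlgebra ℝ (Eu n)} (hb : b ∈ ⋀[ℝ]^k (Eu n)) :
    HasDegree n k (E.const b) := by
  induction hb using exteriorPower_induction with
  | zero c =>
    rw [AlgHom.commutes]
    exact fun q => algebraMap_mem_exteriorPower_zero c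
  | add k x y hx hy h h' => rw [map_add]; exact h.add h'
  | mul v k x hx h _ =>
    rw [map_mul, const_ι, add_comm]
    exact (hasDegree_ofVF _).mul h

/-- The expansion of a multivector field in the frame. -/
theorem evalAt_eq_sum (hq : q ∈ E.nhd) {ι : Type*} [Fintype ι]
    (B : Module.Basis ι ℝ (ExteriorAlgebra ℝ (Eu n))) (X : MVF n M) :
    evalAt n q X = ∑ b, E.coef (B.coord b) X q • evalAt n q (E.const (B b)) := by
  simp only [E.evalAt_const hq, E.coef_eq q hq, Module.Basis.coord_apply, ← map_smul, ← map_sum,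
    B.sum_repr]
  exact (map_trivInv_map_triv (E.subset hq) _).symm

end LocalFrame

/-- An additive map which is homogeneous with respect to multiplication by functions only depends
on the value at the point. -/
theorem eq_of_evalAt_eq [T2Space M] {B : Type*} [AddCommGroup B] [Module ℝ B] {G : MVF n M → B}
    (hadd : ∀ X Y, G (X + Y) = G X + G Y) (hsmul : ∀ f X, G (ofFun n f * X) = f q • G X)
    {X Y : MVF n M} (h : evalAt n q X = evalAt n q Y) : G X = G Y := by
  obtain ⟨E⟩ := nonempty_localFrame (n := n) q
  let B := Module.finBasis ℝ (ExteriorAlgebra ℝ (Eu n))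
  let G' : MVF n M →+ _ := AddMonoidHom.mk' G hadd
  suffices H : ∀ Z, evalAt n q Z = 0 → G' Z = 0 by
    have := H (X - Y) (by rw [map_sub, h, sub_self])
    rwa [map_sub, sub_eq_zero] at this
  intro Z hZ
  -- The frame expansion of `Z`: it agrees with `Z` near `q`, and its coefficients vanish at `q`, so
  -- homogeneity kills `G Z'`.
  let Z' := ∑ b, ofFun n (E.coef (B.coord b) Z) * E.const (B b)
  have h1 : G' Z' = 0 := by
    rw [map_sum]
    refine Finset.sum_eq_zero fun b _ => ?_
    change G _ = 0
    rw [hsmul, E.coef_eq q E.mem]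
    change B.coord b (ExteriorAlgebra.map _ (evalAt n q Z)) • _ = _
    rw [hZ, map_zero, map_zero, zero_smul]
  -- Since `χ (Z - Z') = 0` globally and `χ q = 1`, homogeneity gives `G (Z - Z') = 0`.
  obtain ⟨χ, hχ1, hχ⟩ := exists_bump (n := n) (E.isOpen.mem_nhds E.mem)
  have h2 : ofFun n χ * (Z - Z') = 0 := by
    ext r
    rw [← evalAt_apply, evalAt_ofFun_mul]
    by_cases hr : r ∈ E.nhd
    · rw [map_sub, E.evalAt_eq_sum hr B, map_sum]
      simp only [evalAt_ofFun_mul, sub_self, smul_zero]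
      rfl
    · rw [hχ r hr, zero_smul]
      rfl
  have h3 : G' (Z - Z') = 0 := by
    have := hsmul χ (Z - Z')
    rw [h2, hχ1, one_smul] at this
    exact this.symm.trans (map_zero G')
  rw [map_sub, h1, sub_zero] at h3
  exact h3

/-- Reduces to `eq_of_evalAt_eq` by composing with `toVF`, which is linear over functions on all
multivector fields. -/
theorem eq_of_apply_eq [T2Space M] {B : Type*} [AddCommGroup B] [Module ℝ B]
    {G : VectorField n M → B} (hadd : ∀ X Y, G (X + Y) = G X + G Y)
    (hsmul : ∀ f X, G (funSMul n f X) = f q • G X)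
    {X Y : VectorField n M} (h : X q = Y q) : G X = G Y := by
  have := eq_of_evalAt_eq (q := q) (G := fun Z => G (toVF Z)) (X := ofVF n X) (Y := ofVF n Y)
    (fun X Y => by rw [toVF_add, hadd]) (fun f X => by rw [toVF_ofFun_mul, hsmul])
    (congrArg (ExteriorAlgebra.ι ℝ) h)
  simpa only [toVF_ofVF] using this

variable [T2Space M]

/-- A choice of local frame. -/
def localFrame (n : ℕ) {M : Type*} [TopologicalSpace M] [ChartedSpace (Eu n) M]
    [IsManifold (𝓡 n) ∞ M] [T2Space M] (p : M) : LocalFrame n p := (nonempty_localFrame p).some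

/-- A choice of multivector fields with given values at `q`. -/
def extend (q : M) : ExteriorAlgebra ℝ (Tan n q) →ₐ[ℝ] MVF n M :=
  (localFrame n q).const.comp (ExteriorAlgebra.map (triv n q q))

theorem evalAt_extend (x : ExteriorAlgebra ℝ (Tan n q)) : evalAt n q (extend q x) = x := by
  change evalAt n q ((localFrame n q).const (ExteriorAlgebra.map (triv n q q) x)) = x
  rw [LocalFrame.evalAt_const _ (localFrame n q).mem, map_trivInv_map_triv (mem_chart_source _ q)]

theorem hasDegree_extend {k : ℕ} {x : ExteriorAlgebra ℝ (Tan n q)} (hx : x ∈ ⋀[ℝ]^k (Tan n q)) :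
    HasDegree n k (extend q x) :=
  LocalFrame.hasDegree_const _ (map_mem_exteriorPower _ hx)

/-- Lets the restriction to vector fields be used on extensions of products of vectors. -/
theorem exists_extend_ι (v : Tan n q) :
    ∃ V : VectorField n M, extend q (ExteriorAlgebra.ι ℝ v) = ofVF n V := by
  refine ⟨(localFrame n q).vec (triv n q q v), ?_⟩
  change (localFrame n q).const (ExteriorAlgebra.map _ _) = _
  rw [ExteriorAlgebra.map_apply_ι, LocalFrame.const_ι]

end Frame

/-! ### Rules for differentials and affine connections. -/

section Differential

variable {n : ℕ} {M : Type*} [TopologicalSpace M] [ChartedSpace (Eu n) M]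
  {q : M}

open Filter Topology

theorem differential_congr {f g : SmoothFun n M} (h : ∀ᶠ r in 𝓝 q, f r = g r) :
    differential f q = differential g q :=
  LinearMap.ext fun v => by
    have := EventuallyEq.mfderiv_eq (I := 𝓡 n) (I' := 𝓘(ℝ, ℝ)) h
    exact DFunLike.congr_fun this v

theorem differential_const (c : ℝ) :
    differential (ContMDiffMap.const c : SmoothFun n M) q = 0 :=
  LinearMap.ext fun v => by
    have : mfderiv (𝓡 n) 𝓘(ℝ, ℝ) (fun _ : M => c) q = 0 := mfderiv_const
    exact DFunLike.congr_fun this v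

theorem differential_add (f g : SmoothFun n M) :
    differential (f + g) q = differential f q + differential g q :=
  LinearMap.ext fun v =>
    DFunLike.congr_fun (mfderiv_add (mdifferentiableAt f q) (mdifferentiableAt g q)) v

theorem differential_mul (f g : SmoothFun n M) :
    differential (f * g) q = f q • differential g q + g q • differential f q :=
  LinearMap.ext fun v => by
    have := ((mdifferentiableAt f q).hasMFDerivAt.mul (mdifferentiableAt g q).hasMFDerivAt).mfderiv
    exact DFunLike.congr_fun this v

variable [IsManifold (𝓡 n) ∞ M]

theorem funSMul_const (c : ℝ) (V : VectorField n M) :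
    funSMul n (ContMDiffMap.const c) V = c • V := rfl

theorem funSMul_one (V : VectorField n M) : funSMul n 1 V = V := by
  ext r
  exact one_smul ℝ (V r)

namespace AffineConnection

variable (A : AffineConnection n M)

theorem add_left (V V' W : VectorField n M) :
    A.toFun (V + V') W = A.toFun V W + A.toFun V' W := by
  simpa only [funSMul_one] using A.smul_add_left 1 V V' W

theorem zero_left (W : VectorField n M) : A.toFun 0 W = 0 := by
  simpa using A.add_left 0 0 W

theorem funSMul_left (f : SmoothFun n M) (V W : VectorField n M) :
    A.toFun (funSMul n f V) W = funSMul n f (A.toFun V W) := by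
  simpa only [add_zero, A.zero_left] using A.smul_add_left f V 0 W

theorem smul_right (c : ℝ) (V W : VectorField n M) :
    A.toFun V (c • W) = c • A.toFun V W := by
  ext r
  rw [← funSMul_const, A.leibniz, dirDeriv_eq, differential_const]
  exact (congrArg (· + _) (zero_smul ℝ _)).trans (zero_add _)

end AffineConnection

end Differential

/-! ### Induced connections at a point: uniqueness. -/

section InducedAt

variable {n : ℕ} {M : Type*} [TopologicalSpace M] [ChartedSpace (Eu n) M]
  [IsManifold (𝓡 n) ∞ M] {q : M}

open CliffordAlgebra (contractRight)

/-- The value at `q` of an induced higher connection. -/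
structure IsInducedAt (A : AffineConnection n M) (q : M)
    (T : MVF n M → MVF n M → ExteriorAlgebra ℝ (Tan n q)) : Prop where
  degree : ∀ (k l m : ℕ) (X Y : MVF n M), k + l = m + 1 → HasDegree n k X → HasDegree n l Y →
    T X Y ∈ ⋀[ℝ]^m (Tan n q)
  smul_add_left : ∀ (f : SmoothFun n M) (X X' Y : MVF n M),
    T (ofFun n f * X + X') Y = f q • T X Y + T X' Y
  add_right : ∀ X Y Y' : MVF n M, T X (Y + Y') = T X Y + T X Y'
  apply_fun : ∀ (X : MVF n M) (f : SmoothFun n M),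
    T X (ofFun n f) = contractRight (evalAt n q X) (differential f q)
  leibniz : ∀ (X Y : MVF n M) (f : SmoothFun n M),
    T X (ofFun n f * Y) =
      contractRight (evalAt n q X) (differential f q) * evalAt n q Y + f q • T X Y
  fun_left : ∀ (f : SmoothFun n M) (X : MVF n M), T (ofFun n f) X = 0
  mul_left : ∀ (k l : ℕ) (X Y Z : MVF n M), HasDegree n k X → HasDegree n l Y →
    T (X * Y) Z = evalAt n q X * T Y Z + (-1) ^ (k * l) * (evalAt n q Y * T X Z)
  mul_right : ∀ (k l : ℕ) (X Y Z : MVF n M), HasDegree n k X → HasDegree n l Y →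
    T X (Y * Z) = T X Y * evalAt n q Z + (-1) ^ ((k + 1) * l) * (evalAt n q Y * T X Z)
  restrict : ∀ V W : VectorField n M,
    T (ofVF n V) (ofVF n W) = ExteriorAlgebra.ι ℝ (A.toFun V W q)

namespace IsInducedAt

variable {A : AffineConnection n M} {T T' : MVF n M → MVF n M → ExteriorAlgebra ℝ (Tan n q)}

theorem add_left (h : IsInducedAt A q T) (X X' Y : MVF n M) : T (X + X') Y = T X Y + T X' Y := by
  have := h.smul_add_left 1 X X' Y
  rw [ofFun_one_mul] at this
  exact this.trans (congrArg (· + _) (one_smul ℝ _))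

theorem zero_left (h : IsInducedAt A q T) (Y : MVF n M) : T 0 Y = 0 := by
  simpa using h.add_left 0 0 Y

theorem smul_left (h : IsInducedAt A q T) (f : SmoothFun n M) (X Y : MVF n M) :
    T (ofFun n f * X) Y = f q • T X Y := by
  simpa [h.zero_left] using h.smul_add_left f X 0 Y

theorem algebraMap_eq_ofFun (c : ℝ) :
    algebraMap ℝ (MVF n M) c = ofFun n (ContMDiffMap.const c) := rfl

/-- Since `extend q` is multiplicative, the product rule in the second argument splits off one
vector at a time; the affine connection settles vectors and the differential settles scalars. -/
theorem apply_extend_ι_eq [T2Space M] (h : IsInducedAt A q T) (h' : IsInducedAt A q T')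
    (v : Tan n q) {l : ℕ} {y : ExteriorAlgebra ℝ (Tan n q)} (hy : y ∈ ⋀[ℝ]^l (Tan n q)) :
    T (extend q (ExteriorAlgebra.ι ℝ v)) (extend q y) =
      T' (extend q (ExteriorAlgebra.ι ℝ v)) (extend q y) := by
  induction hy using exteriorPower_induction with
  | zero c => rw [AlgHom.commutes, algebraMap_eq_ofFun, h.apply_fun, h'.apply_fun]
  | add l y y' _ _ hy hy' => rw [map_add, h.add_right, h'.add_right, hy, hy']
  | mul w l y _ hy _ =>
    obtain ⟨V, hV⟩ := exists_extend_ι v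
    obtain ⟨W, hW⟩ := exists_extend_ι w
    rw [hV] at hy
    rw [map_mul, hV, hW, h.mul_right 1 1 _ _ _ (hasDegree_ofVF V) (hasDegree_ofVF W),
      h'.mul_right 1 1 _ _ _ (hasDegree_ofVF V) (hasDegree_ofVF W), h.restrict, h'.restrict, hy]

theorem apply_extend_eq_of_mem [T2Space M] (h : IsInducedAt A q T) (h' : IsInducedAt A q T')
    {k l : ℕ} {x y : ExteriorAlgebra ℝ (Tan n q)} (hx : x ∈ ⋀[ℝ]^k (Tan n q))
    (hy : y ∈ ⋀[ℝ]^l (Tan n q)) : T (extend q x) (extend q y) = T' (extend q x) (extend q y) := by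
  induction hx using exteriorPower_induction with
  | zero c => rw [AlgHom.commutes, algebraMap_eq_ofFun, h.fun_left, h'.fun_left]
  | add k x x' _ _ hx hx' => rw [map_add, h.add_left, h'.add_left, hx, hx']
  | mul v k x hxk hx _ =>
    have hv' := h.apply_extend_ι_eq h' v hy
    obtain ⟨V, hV⟩ := exists_extend_ι v
    rw [hV] at hv'
    rw [map_mul, hV, h.mul_left 1 k _ _ _ (hasDegree_ofVF V) (hasDegree_extend hxk),
      h'.mul_left 1 k _ _ _ (hasDegree_ofVF V) (hasDegree_extend hxk), hx, hv']

theorem apply_extend_eq [T2Space M] (h : IsInducedAt A q T) (h' : IsInducedAt A q T')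
    (x y : ExteriorAlgebra ℝ (Tan n q)) :
    T (extend q x) (extend q y) = T' (extend q x) (extend q y) := by
  induction x using graded_induction with
  | add x x' hx hx' => rw [map_add, h.add_left, h'.add_left, hx, hx']
  | homogeneous k x hx =>
    induction y using graded_induction with
    | add y y' hy hy' => rw [map_add, h.add_right, h'.add_right, hy, hy']
    | homogeneous l y hy => exact h.apply_extend_eq_of_mem h' hx hy

/-- An induced higher connection is determined by the affine connection. -/
theorem unique [T2Space M] (h : IsInducedAt A q T) (h' : IsInducedAt A q T') : T = T' := by
  funext X Y
  rw [← sub_eq_zero]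
  -- The Leibniz terms of `T` and `T'` are equal and cancel, so the difference is tensorial in `Y`;
  -- after this it is treated in the same way in `X`.
  have e₁ : T X Y - T' X Y = T X (extend q (evalAt n q Y)) - T' X (extend q (evalAt n q Y)) := by
    refine eq_of_evalAt_eq (q := q) (G := fun Y => T X Y - T' X Y) (fun Y Y' => ?_) (fun f Y => ?_)
      (evalAt_extend _).symm
    · rw [h.add_right, h'.add_right]
      abel
    · rw [h.leibniz, h'.leibniz, smul_sub]
      abel
  rw [e₁]
  refine (eq_of_evalAt_eq (q := q)
    (G := fun X => T X (extend q (evalAt n q Y)) - T' X (extend q (evalAt n q Y)))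
    (fun Y Y' => ?_) (fun f Y => ?_) (evalAt_extend (evalAt n q X)).symm).trans ?_
  · rw [h.add_left, h'.add_left]
    abel
  · rw [h.smul_left, h'.smul_left, smul_sub]
  · exact sub_eq_zero.2 (h.apply_extend_eq h' _ _)

end IsInducedAt

end InducedAt

/-! ### Homogeneous components of multivector fields. -/

section Component

variable {n : ℕ} {M : Type*} [TopologicalSpace M] [ChartedSpace (Eu n) M]
  [IsManifold (𝓡 n) ∞ M] {q : M}

open Filter Topology

/-- The homogeneous component of degree `k` of a multivector field. -/
def degreePart (k : ℕ) (X : MVF n M) : MVF n M :=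
  ⟨fun q => component _ k (X.1 q), fun p =>
    ((X.2 p).linear (component _ k)).congr (Eventually.of_forall fun _ => (component_map _ _ _).symm)⟩

theorem HasDegree.evalAt_mem {k : ℕ} {X : MVF n M} (hX : HasDegree n k X) :
    evalAt n q X ∈ ⋀[ℝ]^k (Tan n q) := hX q

theorem evalAt_degreePart (k : ℕ) (X : MVF n M) :
    evalAt n q (degreePart k X) = component _ k (evalAt n q X) := rfl

theorem hasDegree_degreePart (k : ℕ) (X : MVF n M) : HasDegree n k (degreePart k X) := fun _ =>
  component_mem k _

theorem degreePart_of_hasDegree {k : ℕ} {X : MVF n M} (hX : HasDegree n k X) (l : ℕ) :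
    degreePart l X = if k = l then X else 0 := by
  ext q
  refine (component_of_mem (hX q) l).trans ?_
  split_ifs <;> rfl

theorem degreePart_add (k : ℕ) (X Y : MVF n M) :
    degreePart k (X + Y) = degreePart k X + degreePart k Y := by
  ext q
  exact map_add (component _ k) (evalAt n q X) (evalAt n q Y)

theorem degreePart_ofFun_mul (k : ℕ) (f : SmoothFun n M) (X : MVF n M) :
    degreePart k (ofFun n f * X) = ofFun n f * degreePart k X := by
  ext q
  rw [← evalAt_apply, ← evalAt_apply, evalAt_ofFun_mul, evalAt_degreePart, evalAt_ofFun_mul,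
    map_smul]
  rfl

theorem finrank_tan {n : ℕ} {M : Type*} [TopologicalSpace M] [ChartedSpace (Eu n) M] (q : M) : Module.finrank ℝ (Tan n q) = n :=
  finrank_euclideanSpace_fin (𝕜 := ℝ)

instance (q : M) : Module.Finite ℝ (Tan n q) :=
  inferInstanceAs (Module.Finite ℝ (Eu n))

theorem sum_degreePart (X : MVF n M) : ∑ k ∈ Finset.range (n + 1), degreePart k X = X := by
  ext q
  rw [← evalAt_apply, map_sum]
  simp only [evalAt_degreePart]
  have h := sum_component (evalAt n q X)
  rwa [finrank_tan] at h

theorem eq_zero_of_hasDegree {k : ℕ} (hk : n < k) {X : MVF n M} (hX : HasDegree n k X) :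
    X = 0 := by
  ext q
  exact exteriorPower_eq_zero (by rwa [finrank_tan]) (hX q)

end Component

/-! ### Covariant derivative of multivector fields along a vector field, in a frame. -/

section Local

variable {n : ℕ} {M : Type*} [TopologicalSpace M] [ChartedSpace (Eu n) M]
  [IsManifold (𝓡 n) ∞ M] {p q : M}

open Filter Topology
open CliffordAlgebra (contractRight)

/-- The derivative along a fixed vector field, as a linear map. -/
def AffineConnection.rightHom (A : AffineConnection n M) (V : VectorField n M) :
    VectorField n M →ₗ[ℝ] VectorField n M where
  toFun := A.toFun V
  map_add' := A.add_right V
  map_smul' c W := A.smul_right c V W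

/-- The derivative of a fixed vector field, as a linear map. -/
def AffineConnection.leftHom (A : AffineConnection n M) (W : VectorField n M) :
    VectorField n M →ₗ[ℝ] VectorField n M where
  toFun V := A.toFun V W
  map_add' V V' := A.add_left V V' W
  map_smul' c V := A.funSMul_left (ContMDiffMap.const c) V W

namespace LocalFrame

variable (E : LocalFrame n p) (A : AffineConnection n M) (V : VectorField n M)

/-- A frame vector and its covariant derivative both have degree one, hence anticommute; this is the
condition in `exists_derivation`. -/
theorem exists_christoffel : ∃ ψ : ExteriorAlgebra ℝ (Eu n) →ₗ[ℝ] MVF n M,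
    (∀ w, ψ (ExteriorAlgebra.ι ℝ w) = ofVF n (A.toFun V (E.vec w))) ∧
      ∀ x y, ψ (x * y) = ψ x * E.const y + E.const x * ψ y := by
  refine exists_derivation E.const (ofVFHom n M ∘ₗ A.rightHom V ∘ₗ E.vec) fun w => ?_
  rw [const_ι]
  ext q
  exact ExteriorAlgebra.ι_add_mul_swap _ _

/-- The covariant derivatives along `V` of the constant multivector fields in the frame. -/
def christoffel : ExteriorAlgebra ℝ (Eu n) →ₗ[ℝ] MVF n M := (E.exists_christoffel A V).choose

theorem christoffel_ι (w : Eu n) :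
    E.christoffel A V (ExteriorAlgebra.ι ℝ w) = ofVF n (A.toFun V (E.vec w)) :=
  (E.exists_christoffel A V).choose_spec.1 w

theorem christoffel_mul (x y : ExteriorAlgebra ℝ (Eu n)) :
    E.christoffel A V (x * y) = E.christoffel A V x * E.const y + E.const x * E.christoffel A V y :=
  (E.exists_christoffel A V).choose_spec.2 x y

theorem christoffel_algebraMap (c : ℝ) : E.christoffel A V (algebraMap ℝ _ c) = 0 := by
  have h := E.christoffel_mul A V 1 1
  rw [map_one E.const, mul_one, mul_one, one_mul, left_eq_add] at h
  rw [Algebra.algebraMap_eq_smul_one, map_smul, h, smul_zero]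

theorem hasDegree_christoffel {k : ℕ} {b : ExteriorAlgebra ℝ (Eu n)} (hb : b ∈ ⋀[ℝ]^k (Eu n)) :
    HasDegree n k (E.christoffel A V b) := by
  induction hb using exteriorPower_induction with
  | zero c => rw [christoffel_algebraMap]; exact fun q => zero_mem _
  | add k x y hx hy h h' => rw [map_add]; exact h.add h'
  | mul w k x hx h _ =>
    rw [christoffel_mul, christoffel_ι, const_ι, add_comm k 1]
    exact ((hasDegree_ofVF _).mul (E.hasDegree_const hx)).add ((hasDegree_ofVF _).mul h)

/-- The covariant derivative of multivector fields in a local frame. -/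
def cov (Y : MVF n M) : MVF n M :=
  let B := Module.finBasis ℝ (ExteriorAlgebra ℝ (Eu n))
  ∑ b, (ofFun n (dirDerivFun n V (E.coef (B.coord b) Y)) * E.const (B b) +
    ofFun n (E.coef (B.coord b) Y) * E.christoffel A V (B b))

variable {E} in
-- With `Y = ∑ Y^b e_b` this is `∑ V(Y^b) e_b + ∑ Y^b ∇_V e_b`; the second sum collapses because
-- `christoffel` is linear.
theorem evalAt_cov (hq : q ∈ E.nhd) (Y : MVF n M) :
    evalAt n q (E.cov A V Y) =
      (∑ b, differential (E.coef ((Module.finBasis ℝ (ExteriorAlgebra ℝ (Eu n))).coord b) Y) q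
        (V q) • evalAt n q (E.const (Module.finBasis ℝ (ExteriorAlgebra ℝ (Eu n)) b))) +
      evalAt n q (E.christoffel A V (localRep n p Y.1 q)) := by
  conv_rhs => rw [← (Module.finBasis ℝ (ExteriorAlgebra ℝ (Eu n))).sum_repr (localRep n p Y.1 q)]
  simp only [cov, map_sum, map_add, evalAt_ofFun_mul, Finset.sum_add_distrib, E.coef_eq q hq,
    map_smul, Module.Basis.coord_apply]
  rfl

theorem localRep_add (Y Z : MVF n M) (r : M) :
    localRep n p (Y + Z).1 r = localRep n p Y.1 r + localRep n p Z.1 r :=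
  map_add (ExteriorAlgebra.map (triv n p r)) (evalAt n r Y) (evalAt n r Z)

theorem localRep_ofFun_mul (f : SmoothFun n M) (Z : MVF n M) (r : M) :
    localRep n p (ofFun n f * Z).1 r = f r • localRep n p Z.1 r := by
  change ExteriorAlgebra.map (triv n p r) (evalAt n r (ofFun n f * Z)) = _
  rw [evalAt_ofFun_mul, map_smul]
  rfl

variable {E}

theorem evalAt_cov_add (hq : q ∈ E.nhd) (Y Z : MVF n M) :
    evalAt n q (E.cov A V (Y + Z)) = evalAt n q (E.cov A V Y) + evalAt n q (E.cov A V Z) := by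
  have h : ∀ ξ, differential (E.coef ξ (Y + Z)) q =
      differential (E.coef ξ Y) q + differential (E.coef ξ Z) q := fun ξ => by
    rw [← differential_add]
    refine differential_congr ?_
    filter_upwards [E.isOpen.mem_nhds hq] with r hr
    change _ = E.coef ξ Y r + E.coef ξ Z r
    rw [E.coef_eq r hr, E.coef_eq r hr, E.coef_eq r hr, localRep_add, map_add]
  rw [evalAt_cov A V hq, evalAt_cov A V hq, evalAt_cov A V hq, localRep_add, map_add, map_add]
  simp only [h, LinearMap.add_apply, add_smul, Finset.sum_add_distrib]
  abel

/-- The coefficients are controlled only on `E.nhd`, so the product rule for them is an equality of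
germs, which is all that differentials need. -/
theorem evalAt_cov_ofFun_mul (hq : q ∈ E.nhd) (f : SmoothFun n M) (Y : MVF n M) :
    evalAt n q (E.cov A V (ofFun n f * Y)) =
      differential f q (V q) • evalAt n q Y + f q • evalAt n q (E.cov A V Y) := by
  have h : ∀ ξ, differential (E.coef ξ (ofFun n f * Y)) q =
      f q • differential (E.coef ξ Y) q + E.coef ξ Y q • differential f q := fun ξ => by
    rw [← differential_mul]
    refine differential_congr ?_
    filter_upwards [E.isOpen.mem_nhds hq] with r hr
    change _ = f r * E.coef ξ Y r
    rw [E.coef_eq r hr, E.coef_eq r hr, localRep_ofFun_mul, map_smul, smul_eq_mul]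
  rw [evalAt_cov A V hq, evalAt_cov A V hq, localRep_ofFun_mul, map_smul, map_smul,
    E.evalAt_eq_sum hq (Module.finBasis ℝ (ExteriorAlgebra ℝ (Eu n))) Y]
  simp only [h, LinearMap.add_apply, add_smul, Finset.sum_add_distrib, LinearMap.smul_apply,
    smul_add, smul_assoc, Finset.smul_sum, smul_comm (differential f q (V q))]
  abel

theorem evalAt_cov_const (hq : q ∈ E.nhd) (b : ExteriorAlgebra ℝ (Eu n)) :
    evalAt n q (E.cov A V (E.const b)) = evalAt n q (E.christoffel A V b) := by
  have hr : ∀ r ∈ E.nhd, localRep n p (E.const b).1 r = b := fun r hr => by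
    change ExteriorAlgebra.map (triv n p r) (evalAt n r (E.const b)) = b
    rw [E.evalAt_const hr, map_triv_map_trivInv (E.subset hr)]
  have h : ∀ ξ, differential (E.coef ξ (E.const b)) q = 0 := fun ξ => by
    rw [← differential_const (ξ b)]
    refine differential_congr ?_
    filter_upwards [E.isOpen.mem_nhds hq] with r hr'
    rw [E.coef_eq r hr', hr r hr']
    rfl
  rw [evalAt_cov A V hq, hr q hq]
  simp [h]

theorem exists_evalAt_eq_const (hq : q ∈ E.nhd) (X : MVF n M) :
    ∃ b, evalAt n q X = evalAt n q (E.const b) := by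
  refine ⟨localRep n p X.1 q, ?_⟩
  rw [E.evalAt_const hq]
  exact (map_trivInv_map_triv (E.subset hq) _).symm

variable [T2Space M]

/-- The defect `G` of the product rule is tensorial in each factor, so constant fields suffice;
there the rule is `christoffel_mul`. -/
theorem evalAt_cov_mul (hq : q ∈ E.nhd) (Y Z : MVF n M) :
    evalAt n q (E.cov A V (Y * Z)) = evalAt n q (E.cov A V Y) * evalAt n q Z +
      evalAt n q Y * evalAt n q (E.cov A V Z) := by
  let G : MVF n M → MVF n M → ExteriorAlgebra ℝ (Tan n q) := fun Y Z =>
    evalAt n q (E.cov A V (Y * Z)) - (evalAt n q (E.cov A V Y) * evalAt n q Z +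
      evalAt n q Y * evalAt n q (E.cov A V Z))
  obtain ⟨b, hb⟩ := exists_evalAt_eq_const hq Y
  obtain ⟨c, hc⟩ := exists_evalAt_eq_const hq Z
  have h₁ : G Y Z = G (E.const b) Z := by
    refine eq_of_evalAt_eq (q := q) (G := fun Y => G Y Z) (fun Y Y' => ?_) (fun f Y => ?_) hb
    · simp only [G, add_mul, evalAt_cov_add A V hq, map_add]
      abel
    · simp only [G, mul_assoc, evalAt_cov_ofFun_mul A V hq, add_mul, map_mul, smul_mul_assoc,
        smul_sub, smul_add]
      abel
  have h₂ : G (E.const b) Z = G (E.const b) (E.const c) := by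
    refine eq_of_evalAt_eq (q := q) (G := fun Z => G (E.const b) Z) (fun Y Y' => ?_)
      (fun f Y => ?_) hc
    · simp only [G, mul_add, evalAt_cov_add A V hq, map_add]
      abel
    · have e : E.const b * (ofFun n f * Y) = ofFun n f * (E.const b * Y) := by
        ext r
        rw [← evalAt_apply, ← evalAt_apply]
        rw [map_mul, evalAt_ofFun_mul, evalAt_ofFun_mul, map_mul, mul_smul_comm]
      simp only [G, e, evalAt_cov_ofFun_mul A V hq, evalAt_ofFun_mul]
      simp only [mul_add, map_mul, mul_smul_comm, smul_sub, smul_add]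
      abel
  refine sub_eq_zero.1 ((h₁.trans h₂).trans ?_)
  simp only [G]
  rw [← map_mul E.const, evalAt_cov_const A V hq, evalAt_cov_const A V hq,
    evalAt_cov_const A V hq, christoffel_mul, map_add, map_mul, map_mul, sub_self]

theorem evalAt_cov_ofVF (hq : q ∈ E.nhd) (W : VectorField n M) :
    evalAt n q (E.cov A V (ofVF n W)) = ExteriorAlgebra.ι ℝ (A.toFun V W q) := by
  have h : W q = E.vec (triv n p q (W q)) q := by
    rw [E.vec_eq q hq, trivInv_triv (E.subset hq)]
  rw [← sub_eq_zero]
  refine (eq_of_apply_eq (q := q) (G := fun W => evalAt n q (E.cov A V (ofVF n W)) -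
    ExteriorAlgebra.ι ℝ (A.toFun V W q)) (fun W W' => ?_) (fun f W => ?_) h).trans ?_
  · rw [show ofVF n (W + W') = ofVF n W + ofVF n W' from map_add (ofVFHom n M) W W',
      evalAt_cov_add A V hq, A.add_right]
    rw [show (A.toFun V W + A.toFun V W') q = A.toFun V W q + A.toFun V W' q from rfl, map_add]
    abel
  · rw [ofVF_funSMul, evalAt_cov_ofFun_mul A V hq, A.leibniz, dirDeriv_eq, map_add, map_smul,
      map_smul, evalAt_ofVF, smul_sub]
    abel
  · rw [← const_ι, evalAt_cov_const A V hq, christoffel_ι, evalAt_ofVF, sub_self]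

/-- The failure of the derivative to commute with taking components is tensorial, and it vanishes on
constants, whose derivatives keep their degree. -/
theorem evalAt_cov_mem (hq : q ∈ E.nhd) {k : ℕ} {Y : MVF n M} (hY : HasDegree n k Y) :
    evalAt n q (E.cov A V Y) ∈ ⋀[ℝ]^k (Tan n q) := by
  let G : MVF n M → ExteriorAlgebra ℝ (Tan n q) := fun Y =>
    component _ k (evalAt n q (E.cov A V Y)) - evalAt n q (E.cov A V (degreePart k Y))
  have hadd : ∀ Y Z, G (Y + Z) = G Y + G Z := fun Y Z => by
    simp only [G, degreePart_add, evalAt_cov_add A V hq, map_add]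
    abel
  obtain ⟨b, hb⟩ := exists_evalAt_eq_const hq Y
  have h : G Y = G (E.const b) := by
    refine eq_of_evalAt_eq (q := q) hadd (fun f Y => ?_) hb
    simp only [G, degreePart_ofFun_mul, evalAt_cov_ofFun_mul A V hq, map_add, map_smul, smul_sub,
      evalAt_degreePart]
    abel
  have h0 : G (E.const b) = 0 := by
    clear h hb
    induction b using graded_induction with
    | add x y hx hy => rw [map_add, hadd, hx, hy, add_zero]
    | homogeneous l x hx =>
      simp only [G]
      rw [degreePart_of_hasDegree (E.hasDegree_const hx), evalAt_cov_const A V hq,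
        component_of_mem (E.hasDegree_christoffel A V hx).evalAt_mem]
      split_ifs with hl
      · rw [evalAt_cov_const A V hq, sub_self]
      · rw [← map_zero E.const, evalAt_cov_const A V hq, map_zero, map_zero, sub_self]
  have e := sub_eq_zero.1 (h.trans h0)
  rw [degreePart_of_hasDegree hY, if_pos rfl] at e
  rw [← e]
  exact component_mem k _

end LocalFrame

end Local

/-! ### Signs matching the two product rules. -/

section Sign

open CliffordAlgebra (contractRight)

variable {V : Type*} [AddCommGroup V] [Module ℝ V]

/-- The contraction has degree `k - 1`, of the same parity as `k + 1`; for `k = 0` both sides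
vanish. -/
theorem contractRight_mul_comm (d : Module.Dual ℝ V) {k l : ℕ} {x y : ExteriorAlgebra ℝ V}
    (hx : x ∈ ⋀[ℝ]^k V) (hy : y ∈ ⋀[ℝ]^l V) :
    contractRight x d * y = (-1) ^ ((k + 1) * l) * (y * contractRight x d) := by
  cases k with
  | zero => rw [contractRight_of_mem_zero hx, zero_mul, mul_zero, mul_zero]
  | succ k =>
    rw [exteriorPower_mul_comm (contractRight_mem hx d) hy, add_assoc, add_mul, pow_add,
      (by simp : Even ((1 + 1) * l)).neg_one_pow, mul_one]

/-- The sign `(-1)^l` of the derivation rule meets `(-1)^((k+1)l)` from commuting the factors;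
together they give `(-1)^(kl)`, the sign required for `∇_{X ∧ Y}`. -/
theorem contractRight_mul' (d : Module.Dual ℝ V) {k l : ℕ} {x y : ExteriorAlgebra ℝ V}
    (hx : x ∈ ⋀[ℝ]^k V) (hy : y ∈ ⋀[ℝ]^l V) :
    contractRight (x * y) d =
      x * contractRight y d + (-1) ^ (k * l) * (y * contractRight x d) := by
  rw [contractRight_mul d x hy, contractRight_mul_comm d hx hy, ← mul_assoc, ← pow_add, add_mul,
    one_mul, add_comm l, add_assoc, pow_add, (Even.add_self l).neg_one_pow, mul_one]

end Sign

/-! ### Construction and gluing of the induced connection. -/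

section Local

variable {n : ℕ} {M : Type*} [TopologicalSpace M] [ChartedSpace (Eu n) M]
  [IsManifold (𝓡 n) ∞ M] {p q : M}

open Filter Topology
open CliffordAlgebra (contractRight)

namespace LocalFrame

variable (E : LocalFrame n p) (A : AffineConnection n M)

/-- The contraction with a coordinate covector of the frame. -/
def contract (a : Fin n) (X : MVF n M) : MVF n M :=
  let B := Module.finBasis ℝ (ExteriorAlgebra ℝ (Eu n))
  ∑ b, ofFun n (E.coef (B.coord b) X) * E.const (contractRight (B b) (dx n a))

variable {E}

theorem evalAt_contract (hq : q ∈ E.nhd) (a : Fin n) (X : MVF n M) :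
    evalAt n q (E.contract a X) = contractRight (evalAt n q X) (dx n a ∘ₗ triv n p q) := by
  let B := Module.finBasis ℝ (ExteriorAlgebra ℝ (Eu n))
  have hd : (dx n a ∘ₗ triv n p q) ∘ₗ trivInv n p q = dx n a :=
    LinearMap.ext fun v => congrArg (dx n a) (triv_trivInv (E.subset hq) v)
  rw [E.evalAt_eq_sum hq B X]
  simp only [contract, map_sum, evalAt_ofFun_mul, LinearMap.sum_apply, map_smul,
    LinearMap.smul_apply, E.evalAt_const hq]
  refine Finset.sum_congr rfl fun b _ => ?_
  rw [contractRight_map, hd]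

/-- Expand the covector as `d = ∑ₐ d(e_a) θ^a`, where `θ^a` is the coframe `dx n a ∘ₗ triv n p q`.
-/
theorem sum_contract (hq : q ∈ E.nhd) (d : Module.Dual ℝ (Tan n q))
    (x : ExteriorAlgebra ℝ (Tan n q)) :
    ∑ a, d (E.vec (EuclideanSpace.single a 1) q) • contractRight x (dx n a ∘ₗ triv n p q) =
      contractRight x d := by
  have h : d = (d ∘ₗ trivInv n p q) ∘ₗ triv n p q :=
    LinearMap.ext fun v => congrArg d (trivInv_triv (E.subset hq) v).symm
  have h' : d = ∑ a, d (E.vec (EuclideanSpace.single a 1) q) • (dx n a ∘ₗ triv n p q) := by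
    conv_lhs => rw [h, ← sum_smul_dx (d ∘ₗ trivInv n p q)]
    refine LinearMap.ext fun v => ?_
    simp only [LinearMap.comp_apply, LinearMap.sum_apply, LinearMap.smul_apply, E.vec_eq q hq]
  conv_rhs => rw [h']
  simp only [map_sum, map_smul]

variable (E) in
/-- The induced higher connection near `p`. -/
def inducedConn (X Y : MVF n M) : MVF n M :=
  ∑ a, E.contract a X * E.cov A (E.vec (EuclideanSpace.single a 1)) Y

theorem evalAt_inducedConn (hq : q ∈ E.nhd) (X Y : MVF n M) :
    evalAt n q (E.inducedConn A X Y) = ∑ a, contractRight (evalAt n q X) (dx n a ∘ₗ triv n p q) *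
      evalAt n q (E.cov A (E.vec (EuclideanSpace.single a 1)) Y) := by
  simp only [inducedConn, map_sum, map_mul, evalAt_contract hq]

theorem evalAt_cov_ofFun (hq : q ∈ E.nhd) (V : VectorField n M) (f : SmoothFun n M) :
    evalAt n q (E.cov A V (ofFun n f)) = algebraMap ℝ _ (differential f q (V q)) := by
  have h : evalAt n q (E.cov A V 1) = 0 := by
    rw [← map_one E.const, evalAt_cov_const A V hq, ← map_one (algebraMap ℝ _),
      christoffel_algebraMap, map_zero]
  rw [← mul_one (ofFun n f), evalAt_cov_ofFun_mul A V hq, h, smul_zero, add_zero, map_one,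
    Algebra.algebraMap_eq_smul_one]

theorem isInducedAt_inducedConn [T2Space M] (hq : q ∈ E.nhd) :
    IsInducedAt A q fun X Y => evalAt n q (E.inducedConn A X Y) where
  degree k l m X Y h hX hY := by
    rw [evalAt_inducedConn A hq]
    refine Submodule.sum_mem _ fun a _ => ?_
    cases k with
    | zero => rw [contractRight_of_mem_zero hX.evalAt_mem, zero_mul]; exact zero_mem _
    | succ k =>
      obtain rfl : m = k + l := by omega
      exact mul_mem_exteriorPower (contractRight_mem hX.evalAt_mem _) (evalAt_cov_mem A _ hq hY)
  smul_add_left f X X' Y := by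
    simp only [evalAt_inducedConn A hq, map_add, evalAt_ofFun_mul, map_smul, LinearMap.add_apply,
      LinearMap.smul_apply, add_mul, Finset.sum_add_distrib, smul_mul_assoc, Finset.smul_sum]
  add_right X Y Y' := by
    simp only [evalAt_inducedConn A hq, evalAt_cov_add A _ hq, mul_add, Finset.sum_add_distrib]
  apply_fun X f := by
    simp only [evalAt_inducedConn A hq, evalAt_cov_ofFun A hq, ← Algebra.commutes,
      ← Algebra.smul_def]
    exact sum_contract hq _ _
  leibniz X Y f := by
    simp only [evalAt_inducedConn A hq, evalAt_cov_ofFun_mul A _ hq, mul_add,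
      Finset.sum_add_distrib, mul_smul_comm, ← smul_mul_assoc, ← Finset.sum_mul]
    rw [sum_contract hq, Finset.smul_sum]
    simp only [smul_mul_assoc]
  fun_left f X := by
    simp only [evalAt_inducedConn A hq, contractRight_of_mem_zero (hasDegree_ofFun f).evalAt_mem,
      zero_mul, Finset.sum_const_zero]
  mul_left k l X Y Z hX hY := by
    simp only [evalAt_inducedConn A hq, map_mul, contractRight_mul' _ hX.evalAt_mem hY.evalAt_mem,
      add_mul, Finset.sum_add_distrib, Finset.mul_sum, mul_assoc]
  mul_right k l X Y Z hX hY := by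
    simp only [evalAt_inducedConn A hq, evalAt_cov_mul A _ hq, mul_add, Finset.sum_add_distrib,
      Finset.mul_sum, Finset.sum_mul, ← mul_assoc,
      contractRight_mul_comm _ hX.evalAt_mem hY.evalAt_mem]
  restrict V W := by
    -- The affine connection is tensorial in `V`, so `V` may be replaced by the frame field with the
    -- same value at `q`, which is a real combination of the `e_a`.
    have h : (E.vec (triv n p q (V q))) q = V q := by
      rw [E.vec_eq q hq, trivInv_triv (E.subset hq)]
    have h' : A.toFun V W q = A.toFun (E.vec (triv n p q (V q))) W q :=
      eq_of_apply_eq (q := q) (G := fun V => A.toFun V W q)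
        (fun V V' => by rw [A.add_left]; rfl) (fun f V => by rw [A.funSMul_left]; rfl) h.symm
    have hs : ∀ v : Eu n, v = ∑ a, v a • EuclideanSpace.single a (1 : ℝ) := fun v => by
      ext j
      simp [Pi.single_apply]
    let L : Eu n →ₗ[ℝ] MVF n M := ofVFHom n M ∘ₗ A.leftHom W ∘ₗ E.vec
    simp only [evalAt_inducedConn A hq, evalAt_cov_ofVF A _ hq, evalAt_ofVF, contractRight_ι,
      ← Algebra.smul_def, h']
    have e : evalAt n q (L (triv n p q (V q))) =
        ∑ a, triv n p q (V q) a • evalAt n q (L (EuclideanSpace.single a 1)) := by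
      conv_lhs => rw [hs (triv n p q (V q))]
      simp only [map_sum, map_smul]
    exact e.symm

end LocalFrame

theorem evalAt_neg_one_pow_mul (k : ℕ) (X : MVF n M) :
    evalAt n q ((-1) ^ k * X) = (-1) ^ k * evalAt n q X := by
  rw [map_mul, map_pow, map_neg, map_one]

namespace HigherConnection

variable (D : HigherConnection n M)

theorem ext_evalAt {D D' : HigherConnection n M}
    (h : ∀ q X Y, evalAt n q (D.toFun X Y) = evalAt n q (D'.toFun X Y)) : D = D' :=
  HigherConnection.ext (funext₂ fun X Y => MVF.ext fun q => h q X Y)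

theorem add_left (X X' Y : MVF n M) : D.toFun (X + X') Y = D.toFun X Y + D.toFun X' Y := by
  simpa only [ofFun_one_mul] using D.smul_add_left 1 X X' Y

theorem zero_left (Y : MVF n M) : D.toFun 0 Y = 0 := by
  simpa using D.add_left 0 0 Y

theorem ofFun_mul_left (f : SmoothFun n M) (X Y : MVF n M) :
    D.toFun (ofFun n f * X) Y = ofFun n f * D.toFun X Y := by
  simpa only [add_zero, D.zero_left] using D.smul_add_left f X 0 Y

theorem sum_left {ι : Type*} (s : Finset ι) (X : ι → MVF n M) (Y : MVF n M) :
    D.toFun (∑ i ∈ s, X i) Y = ∑ i ∈ s, D.toFun (X i) Y :=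
  map_sum (AddMonoidHom.mk' (fun X => D.toFun X Y) fun X X' => D.add_left X X' Y) X s

theorem sum_right {ι : Type*} (s : Finset ι) (X : MVF n M) (Y : ι → MVF n M) :
    D.toFun X (∑ i ∈ s, Y i) = ∑ i ∈ s, D.toFun X (Y i) :=
  map_sum (AddMonoidHom.mk' (fun Y => D.toFun X Y) fun Y Y' => D.add_right X Y Y') Y s

/-- The axiom is stated for homogeneous `X`; both sides are additive, so summing over components
removes the restriction. -/
theorem evalAt_apply_fun (X : MVF n M) (f : SmoothFun n M) :
    evalAt n q (D.toFun X (ofFun n f)) = contractRight (evalAt n q X) (differential f q) := by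
  have h : ∀ k, evalAt n q (D.toFun (degreePart k X) (ofFun n f)) =
      contractRight (evalAt n q (degreePart k X)) (differential f q) := fun k => by
    rw [evalAt_apply, D.apply_fun k _ f (hasDegree_degreePart k X), schouten_ofFun]
    rfl
  rw [← sum_degreePart X, D.sum_left, map_sum, map_sum, map_sum, LinearMap.sum_apply]
  exact Finset.sum_congr rfl fun k _ => h k

theorem evalAt_leibniz (X Y : MVF n M) (f : SmoothFun n M) :
    evalAt n q (D.toFun X (ofFun n f * Y)) =
      contractRight (evalAt n q X) (differential f q) * evalAt n q Y +
        f q • evalAt n q (D.toFun X Y) := by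
  have h : ∀ k, evalAt n q (D.toFun (degreePart k X) (ofFun n f * Y)) =
      contractRight (evalAt n q (degreePart k X)) (differential f q) * evalAt n q Y +
        f q • evalAt n q (D.toFun (degreePart k X) Y) := fun k => by
    rw [evalAt_apply, D.leibniz k _ Y f (hasDegree_degreePart k X), ← evalAt_ofFun_mul]
    change schouten n _ (ofFun n f) q * _ + _ = _
    rw [schouten_ofFun]
    rfl
  rw [← sum_degreePart X, D.sum_left, D.sum_left]
  simp only [map_sum, LinearMap.sum_apply, h, Finset.sum_add_distrib, Finset.sum_mul,
    Finset.smul_sum]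

theorem IsInducedBy.isInducedAt {D : HigherConnection n M} {A : AffineConnection n M}
    (h : D.IsInducedBy n A) (q : M) :
    IsInducedAt A q fun X Y => evalAt n q (D.toFun X Y) where
  degree k l m X Y hm hX hY := (D.degree k l m X Y hm hX hY).evalAt_mem
  smul_add_left f X X' Y := by rw [D.smul_add_left, map_add, evalAt_ofFun_mul]
  add_right X Y Y' := by rw [D.add_right, map_add]
  apply_fun X f := D.evalAt_apply_fun X f
  leibniz X Y f := D.evalAt_leibniz X Y f
  fun_left f X := by rw [D.fun_left, map_zero]
  mul_left k l X Y Z hX hY := by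
    rw [(h.1 k l X Y Z hX hY).1, map_add, evalAt_neg_one_pow_mul, map_mul, map_mul]
  mul_right k l X Y Z hX hY := by
    rw [(h.1 k l X Y Z hX hY).2, map_add, evalAt_neg_one_pow_mul, map_mul, map_mul]
  restrict V W := by rw [h.2]; rfl

theorem IsInducedBy.unique [T2Space M] {D D' : HigherConnection n M} {A : AffineConnection n M}
    (h : D.IsInducedBy n A) (h' : D'.IsInducedBy n A) : D = D' :=
  ext_evalAt fun q X Y => congrFun₂ ((h.isInducedAt q).unique (h'.isInducedAt q)) X Y

end HigherConnection

variable [T2Space M] (A : AffineConnection n M)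

/-- The value at `q` of the induced higher connection. -/
def inducedAt (q : M) (X Y : MVF n M) : ExteriorAlgebra ℝ (Tan n q) :=
  evalAt n q ((localFrame n q).inducedConn A X Y)

theorem isInducedAt_inducedAt (q : M) : IsInducedAt A q (inducedAt A q) :=
  LocalFrame.isInducedAt_inducedConn A (localFrame n q).mem

/-- Each point uses its own frame. By pointwise uniqueness, all these values near `p` come from the
single smooth field built in the frame at `p`. -/
theorem isSmoothSection_inducedAt (X Y : MVF n M) :
    IsSmoothSection n fun q => inducedAt A q X Y :=
  isSmoothSection_of_eventuallyEq fun p => by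
    refine ⟨(localFrame n p).inducedConn A X Y, ?_⟩
    filter_upwards [(localFrame n p).eventually_mem] with q hq
    exact congrFun₂ ((isInducedAt_inducedAt A q).unique
      (LocalFrame.isInducedAt_inducedConn A hq)) X Y

/-- The induced higher connection. -/
def inducedConnection : HigherConnection n M where
  toFun X Y := ⟨fun q => inducedAt A q X Y, isSmoothSection_inducedAt A X Y⟩
  degree k l m X Y h hX hY q := (isInducedAt_inducedAt A q).degree k l m X Y h hX hY
  smul_add_left f X X' Y := by
    ext q
    change inducedAt A q _ _ = evalAt n q (ofFun n f * _ + _)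
    rw [map_add, evalAt_ofFun_mul]
    exact (isInducedAt_inducedAt A q).smul_add_left f X X' Y
  add_right X Y Y' := by
    ext q
    exact (isInducedAt_inducedAt A q).add_right X Y Y'
  apply_fun k X f _ := by
    funext q
    rw [schouten_ofFun]
    exact (isInducedAt_inducedAt A q).apply_fun X f
  leibniz k X Y f _ := by
    funext q
    change inducedAt A q _ _ = schouten n X (ofFun n f) q * evalAt n q Y + evalAt n q (ofFun n f * _)
    rw [schouten_ofFun, evalAt_ofFun_mul]
    exact (isInducedAt_inducedAt A q).leibniz X Y f
  fun_left f X := by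
    ext q
    exact (isInducedAt_inducedAt A q).fun_left f X

theorem inducedConnection_isInducedBy : (inducedConnection A).IsInducedBy n A := by
  refine ⟨fun k l X Y Z hX hY => ⟨?_, ?_⟩, fun V W => ?_⟩
  · ext q
    rw [← evalAt_apply, ← evalAt_apply, map_add, evalAt_neg_one_pow_mul, map_mul, map_mul]
    exact (isInducedAt_inducedAt A q).mul_left k l X Y Z hX hY
  · ext q
    rw [← evalAt_apply, ← evalAt_apply, map_add, evalAt_neg_one_pow_mul, map_mul, map_mul]
    exact (isInducedAt_inducedAt A q).mul_right k l X Y Z hX hY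
  · ext q
    exact (isInducedAt_inducedAt A q).restrict V W

theorem existsUnique_inducedConnection : ∃! D : HigherConnection n M, D.IsInducedBy n A :=
  ⟨inducedConnection A, inducedConnection_isInducedBy A, fun _ h =>
    h.unique (inducedConnection_isInducedBy A)⟩

end Local

/-! ### Classification of higher connections by pairs. -/

section Classification

section ExteriorPower

variable {V W : Type*} [AddCommGroup V] [Module ℝ V] [AddCommGroup W] [Module ℝ W]

theorem coe_exteriorPower_map (f : V →ₗ[ℝ] W) (k : ℕ) (x : ⋀[ℝ]^k V) :
    (exteriorPower.map k f x : ExteriorAlgebra ℝ W) = ExteriorAlgebra.map f x := by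
  have h : (⋀[ℝ]^k W).subtype ∘ₗ exteriorPower.map k f =
      (ExteriorAlgebra.map f).toLinearMap ∘ₗ (⋀[ℝ]^k V).subtype := by
    refine exteriorPower.linearMap_ext (AlternatingMap.ext fun v => ?_)
    change (exteriorPower.map k f (exteriorPower.ιMulti ℝ k v) : ExteriorAlgebra ℝ W) =
      ExteriorAlgebra.map f (exteriorPower.ιMulti ℝ k v)
    rw [exteriorPower.map_apply_ιMulti, exteriorPower.ιMulti_apply_coe,
      exteriorPower.ιMulti_apply_coe, ExteriorAlgebra.map_apply_ιMulti]
  exact LinearMap.congr_fun h x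

/-- The homogeneous component of degree `k`, as an element of the exterior power. -/
def toExteriorPower (V : Type*) [AddCommGroup V] [Module ℝ V] (k : ℕ) :
    ExteriorAlgebra ℝ V →ₗ[ℝ] ⋀[ℝ]^k V :=
  (component V k).codRestrict _ (component_mem k)

theorem coe_toExteriorPower (k : ℕ) (x : ExteriorAlgebra ℝ V) :
    (toExteriorPower V k x : ExteriorAlgebra ℝ V) = component V k x := rfl

theorem toExteriorPower_of_mem {k : ℕ} {x : ExteriorAlgebra ℝ V} (hx : x ∈ ⋀[ℝ]^k V) :
    toExteriorPower V k x = ⟨x, hx⟩ :=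
  Subtype.ext ((component_of_mem hx k).trans (if_pos rfl))

theorem toExteriorPower_of_mem_ne {k l : ℕ} {x : ExteriorAlgebra ℝ V} (hx : x ∈ ⋀[ℝ]^k V)
    (h : k ≠ l) : toExteriorPower V l x = 0 :=
  Subtype.ext ((component_of_mem hx l).trans (if_neg h))

theorem toExteriorPower_map (f : V →ₗ[ℝ] W) (k : ℕ) (x : ExteriorAlgebra ℝ V) :
    toExteriorPower W k (ExteriorAlgebra.map f x) =
      exteriorPower.map k f (toExteriorPower V k x) :=
  Subtype.ext (by rw [coe_toExteriorPower, component_map, coe_exteriorPower_map,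
    coe_toExteriorPower])

/-- The scalar part is the same in every chart; hence a field of degree zero is a smooth function.
-/
theorem algebraMapInv_map (f : V →ₗ[ℝ] W) (x : ExteriorAlgebra ℝ V) :
    ExteriorAlgebra.algebraMapInv (ExteriorAlgebra.map f x) =
      ExteriorAlgebra.algebraMapInv (R := ℝ) x := by
  have h : (ExteriorAlgebra.algebraMapInv (R := ℝ)).comp (ExteriorAlgebra.map f) =
      ExteriorAlgebra.algebraMapInv := by
    refine ExteriorAlgebra.hom_ext (LinearMap.ext fun v => ?_)
    change ExteriorAlgebra.algebraMapInv (ExteriorAlgebra.map f (ExteriorAlgebra.ι ℝ v)) =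
      ExteriorAlgebra.algebraMapInv (ExteriorAlgebra.ι ℝ v)
    rw [ExteriorAlgebra.map_apply_ι]
    simp [ExteriorAlgebra.algebraMapInv]
  exact DFunLike.congr_fun h x

theorem algebraMap_algebraMapInv {x : ExteriorAlgebra ℝ V} (hx : x ∈ ⋀[ℝ]^0 V) :
    algebraMap ℝ _ (ExteriorAlgebra.algebraMapInv x) = x := by
  unfold ExteriorAlgebra.exteriorPower at hx
  rw [pow_zero] at hx
  obtain ⟨c, rfl⟩ := Submodule.mem_one.1 hx
  rw [ExteriorAlgebra.algebraMap_leftInverse]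

end ExteriorPower

variable {n : ℕ} {M : Type*} [TopologicalSpace M] [ChartedSpace (Eu n) M]
  [IsManifold (𝓡 n) ∞ M] {p q : M}

open Filter Topology
open CliffordAlgebra (contractRight)

theorem exists_eq_ofFun {X : MVF n M} (hX : HasDegree n 0 X) : ∃ f, X = ofFun n f := by
  refine ⟨⟨fun q => ExteriorAlgebra.algebraMapInv (X.1 q), fun p => ?_⟩, ?_⟩
  · have h := X.2 p (ExteriorAlgebra.algebraMapInv (R := ℝ) (M := Eu n)).toLinearMap
    refine h.congr_of_eventuallyEq (Eventually.of_forall fun q => ?_)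
    exact (algebraMapInv_map _ _).symm
  · ext q
    exact (algebraMap_algebraMapInv (hX q)).symm

namespace TwistField

variable {k l : ℕ} (F : TwistField n M k l)

/-- In a trivialization this is a bilinear map with smooth components applied to two smooth
arguments, so `SmoothAt.apply` is used twice. -/
theorem isSmoothSection_apply (X Y : MVF n M) : IsSmoothSection n fun q =>
    (F.toFun q (toExteriorPower _ k (X.1 q)) (toExteriorPower _ l (Y.1 q)) :
      ExteriorAlgebra ℝ (Tan n q)) := by
  intro p
  let L : ∀ q : M, ⋀[ℝ]^k (Eu n) →ₗ[ℝ] ⋀[ℝ]^l (Eu n) →ₗ[ℝ] ⋀[ℝ]^(k + l - 1) (Eu n) := fun q =>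
    ((F.toFun q).compl₁₂ (exteriorPower.map k (trivInv n p q))
      (exteriorPower.map l (trivInv n p q))).compr₂ (exteriorPower.map (k + l - 1) (triv n p q))
  have hL : ∀ a b, SmoothAt n (fun q => L q a b) p := F.smooth p
  have hx : SmoothAt n (fun q => toExteriorPower _ k (localRep n p X.1 q)) p :=
    (X.2 p).linear (toExteriorPower _ k)
  have hy : SmoothAt n (fun q => toExteriorPower _ l (localRep n p Y.1 q)) p :=
    (Y.2 p).linear (toExteriorPower _ l)
  have h : SmoothAt n (fun q => L q (toExteriorPower _ k (localRep n p X.1 q))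
      (toExteriorPower _ l (localRep n p Y.1 q))) p :=
    SmoothAt.apply (L := fun q => (L q).flip (toExteriorPower _ l (localRep n p Y.1 q)))
      (fun a => SmoothAt.apply (L := fun q => L q a) (hL a) hy) hx
  refine (h.linear (Submodule.subtype _)).congr ?_
  filter_upwards [chart_source_mem_nhds (mem_chart_source (Eu n) p)] with q hq
  change ExteriorAlgebra.map (triv n p q) _ = ((exteriorPower.map (k + l - 1) (triv n p q)
    (F.toFun q (exteriorPower.map k (trivInv n p q) (toExteriorPower _ k (localRep n p X.1 q)))
      (exteriorPower.map l (trivInv n p q) (toExteriorPower _ l (localRep n p Y.1 q)))) :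
        ⋀[ℝ]^(k + l - 1) (Eu n)) : ExteriorAlgebra ℝ (Eu n))
  rw [coe_exteriorPower_map, ← toExteriorPower_map, ← toExteriorPower_map, localRep, localRep,
    map_trivInv_map_triv hq, map_trivInv_map_triv hq]

/-- The action of a section of `E^{k,l}` on multivector fields, through the components of degrees
`k` and `l`. -/
def apply (X Y : MVF n M) : MVF n M :=
  ⟨fun q => (F.toFun q (toExteriorPower _ k (X.1 q)) (toExteriorPower _ l (Y.1 q)) :
    ExteriorAlgebra ℝ (Tan n q)), F.isSmoothSection_apply X Y⟩

theorem evalAt_apply (X Y : MVF n M) : evalAt n q (F.apply X Y) =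
    (F.toFun q (toExteriorPower _ k (evalAt n q X)) (toExteriorPower _ l (evalAt n q Y)) :
      ExteriorAlgebra ℝ (Tan n q)) := rfl

theorem evalAt_apply_of_hasDegree {X Y : MVF n M} (hX : HasDegree n k X) (hY : HasDegree n l Y) :
    evalAt n q (F.apply X Y) = (F.toFun q ⟨X.1 q, hX q⟩ ⟨Y.1 q, hY q⟩ :
      ExteriorAlgebra ℝ (Tan n q)) := by
  rw [evalAt_apply, toExteriorPower_of_mem hX.evalAt_mem, toExteriorPower_of_mem hY.evalAt_mem]
  rfl

end TwistField

namespace ConnectionData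

variable (S : ConnectionData n M)

open scoped Classical in
/-- The term of the higher connection given by the section `F^{k,l}`. -/
def term (k l : ℕ) (X Y : MVF n M) : MVF n M :=
  if h : 0 < k ∧ 0 < l ∧ k + l - 1 ≤ n then (S.twist k l h.1 h.2.1 h.2.2).apply X Y else 0

/-- The tensorial part of the higher connection. -/
def totalTwist (X Y : MVF n M) : MVF n M :=
  ∑ k ∈ Finset.range (n + 1), ∑ l ∈ Finset.range (n + 1), S.term k l X Y

theorem term_of_pos {k l : ℕ} (hk : 0 < k) (hl : 0 < l) (h : k + l - 1 ≤ n) (X Y : MVF n M) :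
    S.term k l X Y = (S.twist k l hk hl h).apply X Y := dif_pos ⟨hk, hl, h⟩

theorem term_smul_add_left (k l : ℕ) (f : SmoothFun n M) (X X' Y : MVF n M) :
    S.term k l (ofFun n f * X + X') Y = ofFun n f * S.term k l X Y + S.term k l X' Y := by
  unfold term
  split_ifs
  · ext q
    rw [← HigherConn.evalAt_apply, ← HigherConn.evalAt_apply]
    simp only [map_add, evalAt_ofFun_mul, TwistField.evalAt_apply, map_smul, LinearMap.add_apply,
      LinearMap.smul_apply, Submodule.coe_add, Submodule.coe_smul]
  · rw [mul_zero, add_zero]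

theorem term_add_right (k l : ℕ) (X Y Y' : MVF n M) :
    S.term k l X (Y + Y') = S.term k l X Y + S.term k l X Y' := by
  unfold term
  split_ifs
  · ext q
    rw [← HigherConn.evalAt_apply, ← HigherConn.evalAt_apply]
    simp only [map_add, TwistField.evalAt_apply, Submodule.coe_add]
  · rw [add_zero]

theorem term_ofFun_mul_right (k l : ℕ) (f : SmoothFun n M) (X Y : MVF n M) :
    S.term k l X (ofFun n f * Y) = ofFun n f * S.term k l X Y := by
  unfold term
  split_ifs
  · ext q
    rw [← HigherConn.evalAt_apply, ← HigherConn.evalAt_apply]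
    simp only [evalAt_ofFun_mul, TwistField.evalAt_apply, map_smul, Submodule.coe_smul]
  · rw [mul_zero]

theorem term_eq_zero {k l k' l' : ℕ} {X Y : MVF n M} (hX : HasDegree n k' X)
    (hY : HasDegree n l' Y) (h : k' ≠ k ∨ l' ≠ l) : S.term k l X Y = 0 := by
  unfold term
  split_ifs
  · ext q
    rw [← HigherConn.evalAt_apply, TwistField.evalAt_apply]
    rcases h with h | h
    · rw [toExteriorPower_of_mem_ne hX.evalAt_mem h, map_zero]
      rfl
    · rw [toExteriorPower_of_mem_ne hY.evalAt_mem h, map_zero]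
      rfl
  · rfl

theorem term_zero_left (l : ℕ) (X Y : MVF n M) : S.term 0 l X Y = 0 :=
  dif_neg fun h => h.1.ne rfl

theorem term_zero_right (k : ℕ) (X Y : MVF n M) : S.term k 0 X Y = 0 :=
  dif_neg fun h => h.2.1.ne rfl

theorem totalTwist_of_hasDegree {k l : ℕ} {X Y : MVF n M} (hX : HasDegree n k X)
    (hY : HasDegree n l Y) (hk : k ≤ n) (hl : l ≤ n) : S.totalTwist X Y = S.term k l X Y := by
  unfold totalTwist
  rw [Finset.sum_eq_single k, Finset.sum_eq_single l]
  · exact fun j _ hj => S.term_eq_zero hX hY (Or.inr hj.symm)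
  · exact fun h => absurd (Finset.mem_range.2 (Nat.lt_succ_of_le hl)) h
  · exact fun j _ hj => Finset.sum_eq_zero fun i _ => S.term_eq_zero hX hY (Or.inl hj.symm)
  · exact fun h => absurd (Finset.mem_range.2 (Nat.lt_succ_of_le hk)) h

theorem totalTwist_add_right (X Y Y' : MVF n M) :
    S.totalTwist X (Y + Y') = S.totalTwist X Y + S.totalTwist X Y' := by
  simp only [totalTwist, term_add_right, Finset.sum_add_distrib]

theorem totalTwist_ofFun_left (f : SmoothFun n M) (Y : MVF n M) :
    S.totalTwist (ofFun n f) Y = 0 :=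
  Finset.sum_eq_zero fun k _ => Finset.sum_eq_zero fun l _ => by
    rcases Nat.eq_zero_or_pos k with rfl | hk
    · exact S.term_zero_left l _ _
    · unfold term
      split_ifs
      · ext q
        rw [← HigherConn.evalAt_apply, TwistField.evalAt_apply,
          toExteriorPower_of_mem_ne (hasDegree_ofFun f).evalAt_mem hk.ne, map_zero]
        rfl
      · rfl

theorem totalTwist_ofFun_right (X : MVF n M) (f : SmoothFun n M) :
    S.totalTwist X (ofFun n f) = 0 :=
  Finset.sum_eq_zero fun k _ => Finset.sum_eq_zero fun l _ => by
    rcases Nat.eq_zero_or_pos l with rfl | hl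
    · exact S.term_zero_right k _ _
    · unfold term
      split_ifs
      · ext q
        rw [← HigherConn.evalAt_apply, TwistField.evalAt_apply,
          toExteriorPower_of_mem_ne (hasDegree_ofFun f).evalAt_mem hl.ne, map_zero]
        rfl
      · rfl

theorem hasDegree_totalTwist {k l m : ℕ} (h : k + l = m + 1) {X Y : MVF n M}
    (hX : HasDegree n k X) (hY : HasDegree n l Y) : HasDegree n m (S.totalTwist X Y) := by
  have hz : HasDegree n m (0 : MVF n M) := fun q => zero_mem _
  intro q
  change evalAt n q _ ∈ _
  rw [totalTwist, map_sum]
  refine Submodule.sum_mem _ fun i _ => ?_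
  rw [map_sum]
  refine Submodule.sum_mem _ fun j _ => ?_
  by_cases hij : k = i ∧ l = j
  · obtain ⟨rfl, rfl⟩ := hij
    unfold term
    split_ifs
    · obtain rfl : m = k + l - 1 := by omega
      exact SetLike.coe_mem _
    · exact hz q
  · rw [S.term_eq_zero hX hY (by tauto), map_zero]
    exact zero_mem _

end ConnectionData

namespace HigherConnection

variable (D : HigherConnection n M)

theorem smul_left (c : ℝ) (X Y : MVF n M) : D.toFun (c • X) Y = c • D.toFun X Y := by
  rw [Algebra.smul_def, Algebra.smul_def, IsInducedAt.algebraMap_eq_ofFun, D.ofFun_mul_left]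

theorem smul_right (c : ℝ) (X Y : MVF n M) : D.toFun X (c • Y) = c • D.toFun X Y := by
  rw [Algebra.smul_def, Algebra.smul_def, IsInducedAt.algebraMap_eq_ofFun]
  ext q
  rw [← evalAt_apply, ← evalAt_apply, D.evalAt_leibniz, differential_const, map_zero, zero_mul,
    zero_add, evalAt_ofFun_mul]

/-- The restriction of a higher connection to vector fields. -/
def affine : AffineConnection n M where
  toFun V W := toVF (D.toFun (ofVF n V) (ofVF n W))
  smul_add_left f V V' W := by
    rw [show ofVF n (funSMul n f V + V') = ofFun n f * ofVF n V + ofVF n V' by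
      rw [← ofVF_funSMul]; exact map_add (ofVFHom n M) _ _, D.smul_add_left, toVF_add,
      toVF_ofFun_mul]
  add_right V W W' := by
    rw [show ofVF n (W + W') = ofVF n W + ofVF n W' from map_add (ofVFHom n M) _ _, D.add_right,
      toVF_add]
  leibniz f V W q := by
    rw [toVF_apply, ofVF_funSMul, D.evalAt_leibniz, evalAt_ofVF, contractRight_ι,
      ← Algebra.smul_def, evalAt_ofVF, map_add, map_smul, map_smul,
      ExteriorAlgebra.ι_leftInverse]
    rfl

theorem ofVF_affine (V W : VectorField n M) :
    ofVF n (D.affine.toFun V W) = D.toFun (ofVF n V) (ofVF n W) :=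
  ofVF_toVF (D.degree 1 1 1 _ _ rfl (hasDegree_ofVF V) (hasDegree_ofVF W))

end HigherConnection

/-- Bidegree `(1, 1)`, where `F` vanishes. It belongs to the index range only when `1 ≤ n`. -/
theorem Decomposes.ofVF_conn (hn : 0 < n) {D : HigherConnection n M} {S : ConnectionData n M}
    (h : Decomposes n D S) (V W : VectorField n M) :
    ofVF n (S.conn.toFun V W) = D.toFun (ofVF n V) (ofVF n W) := by
  obtain ⟨D', hD', h⟩ := h
  ext q
  rw [h 1 1 one_pos one_pos hn _ _ (hasDegree_ofVF V) (hasDegree_ofVF W), S.twist_one_one hn,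
    hD'.2]
  exact (add_zero _).symm

variable [T2Space M]

/-- The higher connection determined by an affine connection and a family of sections. -/
def ConnectionData.higherConnection (S : ConnectionData n M) : HigherConnection n M where
  toFun X Y := (inducedConnection S.conn).toFun X Y + S.totalTwist X Y
  degree k l m X Y h hX hY :=
    ((inducedConnection S.conn).degree k l m X Y h hX hY).add (S.hasDegree_totalTwist h hX hY)
  smul_add_left f X X' Y := by
    simp only [HigherConnection.smul_add_left, totalTwist, term_smul_add_left,
      Finset.sum_add_distrib, mul_add, Finset.mul_sum]
    abel
  add_right X Y Y' := by
    rw [HigherConnection.add_right, S.totalTwist_add_right]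
    abel
  apply_fun k X f hX := by
    rw [S.totalTwist_ofFun_right, add_zero]
    exact (inducedConnection S.conn).apply_fun k X f hX
  leibniz k X Y f hX := by
    have h : S.totalTwist X (ofFun n f * Y) = ofFun n f * S.totalTwist X Y := by
      simp only [totalTwist, term_ofFun_mul_right, Finset.mul_sum]
    have h' := (inducedConnection S.conn).leibniz k X Y f hX
    funext q
    change _ + evalAt n q (S.totalTwist X _) = _ + evalAt n q (ofFun n f * (_ + _))
    rw [h, mul_add, map_add, ← add_assoc]
    exact congrArg (· + evalAt n q (ofFun n f * S.totalTwist X Y)) (congrFun h' q)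
  fun_left f X := by
    rw [HigherConnection.fun_left, S.totalTwist_ofFun_left, add_zero]

theorem ConnectionData.decomposes (S : ConnectionData n M) :
    Decomposes n S.higherConnection S := by
  refine ⟨inducedConnection S.conn, inducedConnection_isInducedBy _,
    fun k l hk hl h X Y hX hY q => ?_⟩
  change _ + evalAt n q (S.totalTwist X Y) = _
  rw [S.totalTwist_of_hasDegree hX hY (by omega) (by omega), S.term_of_pos hk hl h,
    TwistField.evalAt_apply_of_hasDegree _ hX hY]

/-- A higher connection is determined by the corresponding pair. -/
theorem Decomposes.unique {D₁ D₂ : HigherConnection n M} {S : ConnectionData n M}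
    (h₁ : Decomposes n D₁ S) (h₂ : Decomposes n D₂ S) : D₁ = D₂ := by
  obtain ⟨D, hD, h₁⟩ := h₁
  obtain ⟨D', hD', h₂⟩ := h₂
  obtain rfl := hD.unique hD'
  have key : ∀ (k l : ℕ) (X Y : MVF n M), HasDegree n k X → HasDegree n l Y →
      D₁.toFun X Y = D₂.toFun X Y := by
    intro k l X Y hX hY
    -- The relation says nothing in degree zero; there the axioms for functions fix both
    -- connections.
    rcases Nat.eq_zero_or_pos k with rfl | hk
    · obtain ⟨f, rfl⟩ := exists_eq_ofFun hX
      rw [D₁.fun_left, D₂.fun_left]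
    rcases Nat.eq_zero_or_pos l with rfl | hl
    · obtain ⟨f, rfl⟩ := exists_eq_ofFun hY
      exact Subtype.ext ((D₁.apply_fun k X f hX).trans (D₂.apply_fun k X f hX).symm)
    by_cases h : k + l - 1 ≤ n
    · ext q
      rw [h₁ k l hk hl h X Y hX hY, h₂ k l hk hl h X Y hX hY]
    -- Above the top degree both values are zero.
    · have hm : k + l = (k + l - 1) + 1 := by omega
      rw [eq_zero_of_hasDegree (not_le.1 h) (D₁.degree k l _ X Y hm hX hY),
        eq_zero_of_hasDegree (not_le.1 h) (D₂.degree k l _ X Y hm hX hY)]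
  refine HigherConnection.ext (funext₂ fun X Y => ?_)
  rw [← sum_degreePart X, ← sum_degreePart Y]
  simp only [HigherConnection.sum_left, HigherConnection.sum_right]
  exact Finset.sum_congr rfl fun l _ => Finset.sum_congr rfl fun k _ =>
    key k l _ _ (hasDegree_degreePart k X) (hasDegree_degreePart l Y)

namespace HigherConnection

variable (D D' : HigherConnection n M)

/-- A higher connection at a point, evaluated on the chosen extensions. -/
def onExtensions (q : M) : ExteriorAlgebra ℝ (Tan n q) →ₗ[ℝ] ExteriorAlgebra ℝ (Tan n q) →ₗ[ℝ]
    ExteriorAlgebra ℝ (Tan n q) :=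
  (LinearMap.mk₂ ℝ D.toFun D.add_left D.smul_left D.add_right D.smul_right).compl₁₂
    (extend q).toLinearMap (extend q).toLinearMap |>.compr₂ (evalAt n q).toLinearMap

/-- The difference of two higher connections at a point, as a bilinear map. -/
def difference (q : M) : ExteriorAlgebra ℝ (Tan n q) →ₗ[ℝ] ExteriorAlgebra ℝ (Tan n q) →ₗ[ℝ]
    ExteriorAlgebra ℝ (Tan n q) :=
  D.onExtensions q - D'.onExtensions q

/-- The Leibniz term depends only on `X`, `Y` and `df` at `q`, not on the connection, so the
difference is tensorial and the chosen extensions do not matter. -/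
theorem difference_evalAt (X Y : MVF n M) : D.difference D' q (evalAt n q X) (evalAt n q Y) =
    evalAt n q (D.toFun X Y) - evalAt n q (D'.toFun X Y) := by
  refine (eq_of_evalAt_eq (q := q) (G := fun X => evalAt n q (D.toFun X (extend q (evalAt n q Y))) -
    evalAt n q (D'.toFun X (extend q (evalAt n q Y)))) (fun X X' => ?_) (fun f X => ?_)
    (evalAt_extend (evalAt n q X))).trans (eq_of_evalAt_eq (q := q)
    (G := fun Y => evalAt n q (D.toFun X Y) - evalAt n q (D'.toFun X Y)) (fun Y Y' => ?_)
    (fun f Y => ?_) (evalAt_extend (evalAt n q Y)))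
  · rw [D.add_left, D'.add_left, map_add, map_add]
    abel
  · rw [D.ofFun_mul_left, D'.ofFun_mul_left, evalAt_ofFun_mul, evalAt_ofFun_mul, smul_sub]
  · rw [D.add_right, D'.add_right, map_add, map_add]
    abel
  · rw [D.evalAt_leibniz, D'.evalAt_leibniz, add_sub_add_left_eq_sub, smul_sub]

theorem difference_mem {k l : ℕ} (hk : 0 < k) {x y : ExteriorAlgebra ℝ (Tan n q)}
    (hx : x ∈ ⋀[ℝ]^k (Tan n q)) (hy : y ∈ ⋀[ℝ]^l (Tan n q)) :
    D.difference D' q x y ∈ ⋀[ℝ]^(k + l - 1) (Tan n q) := by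
  have h : k + l = (k + l - 1) + 1 := by omega
  exact sub_mem (D.degree k l _ _ _ h (hasDegree_extend hx) (hasDegree_extend hy)).evalAt_mem
    (D'.degree k l _ _ _ h (hasDegree_extend hx) (hasDegree_extend hy)).evalAt_mem

/-- The component in `Γ(E^{k,l})` of the difference of two higher connections. -/
def differenceField (k l : ℕ) (hk : 0 < k) : TwistField n M k l where
  toFun q := LinearMap.mk₂ ℝ
    (fun x y => ⟨D.difference D' q x y, D.difference_mem D' hk x.2 y.2⟩)
    (fun x x' y => Subtype.ext (LinearMap.map_add₂ _ _ _ _))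
    (fun c x y => Subtype.ext (LinearMap.map_smul₂ _ _ _ _))
    (fun x y y' => Subtype.ext (map_add _ _ _))
    (fun c x y => Subtype.ext (map_smul _ _ _))
  smooth p a b := by
    let E := localFrame n p
    -- Near `p` the frame constants take the values `trivInv a` and `trivInv b`, so the component to
    -- be checked is the local representation of the smooth field `Z`.
    let Z := D.toFun (E.const a) (E.const b) - D'.toFun (E.const a) (E.const b)
    refine SmoothAt.of_linear_injective (Submodule.subtype _) (Submodule.subtype_injective _)
      ((Z.2 p).congr ?_)
    filter_upwards [E.eventually_mem] with q hq
    change (exteriorPower.map (k + l - 1) (triv n p q) _ : ExteriorAlgebra ℝ (Eu n)) =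
      ExteriorAlgebra.map (triv n p q) (evalAt n q Z)
    rw [coe_exteriorPower_map]
    congr 1
    change D.difference D' q (exteriorPower.map k (trivInv n p q) a : ExteriorAlgebra ℝ (Tan n q))
      (exteriorPower.map l (trivInv n p q) b : ExteriorAlgebra ℝ (Tan n q)) = _
    rw [coe_exteriorPower_map, coe_exteriorPower_map, ← E.evalAt_const hq, ← E.evalAt_const hq,
      difference_evalAt, map_sub]

/-- The affine connection and the sections of `E^{k,l}` determined by a higher connection. -/
def data : ConnectionData n M where
  conn := D.affine
  twist k l hk _ _ := D.differenceField (inducedConnection D.affine) k l hk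
  twist_one_one h p := by
    refine LinearMap.ext fun x => LinearMap.ext fun y => Subtype.ext ?_
    change evalAt n p (D.toFun (extend p x) (extend p y)) -
      evalAt n p ((inducedConnection D.affine).toFun (extend p x) (extend p y)) = 0
    obtain ⟨V, hV⟩ := exists_extend_ι (ExteriorAlgebra.ιInv (x : ExteriorAlgebra ℝ (Tan n p)))
    obtain ⟨W, hW⟩ := exists_extend_ι (ExteriorAlgebra.ιInv (y : ExteriorAlgebra ℝ (Tan n p)))
    rw [ι_ιInv x.2] at hV
    rw [ι_ιInv y.2] at hW
    rw [hV, hW, (inducedConnection_isInducedBy D.affine).2, ofVF_affine, sub_self]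

theorem decomposes_data : Decomposes n D D.data := by
  refine ⟨inducedConnection D.affine, inducedConnection_isInducedBy _,
    fun k l hk hl h X Y hX hY q => ?_⟩
  change evalAt n q (D.toFun X Y) = evalAt n q ((inducedConnection D.affine).toFun X Y) +
    D.difference (inducedConnection D.affine) q (evalAt n q X) (evalAt n q Y)
  rw [difference_evalAt, add_sub_cancel]

end HigherConnection

/-- The pair corresponding to a higher connection is unique. -/
theorem Decomposes.data_unique {D : HigherConnection n M} {S S' : ConnectionData n M}
    (h : Decomposes n D S) (h' : Decomposes n D S') : S = S' := by
  have hconn : S.conn = S'.conn := by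
    refine AffineConnection.ext (funext₂ fun V W => ?_)
    -- For `n = 0` the relation does not reach bidegree `(1, 1)`, but the tangent spaces are zero.
    rcases Nat.eq_zero_or_pos n with rfl | hn
    · ext q
      exact Subsingleton.elim (α := Eu 0) _ _
    · exact ofVF_injective ((h.ofVF_conn hn V W).trans (h'.ofVF_conn hn V W).symm)
  obtain ⟨D₁, hD₁, h₁⟩ := h
  obtain ⟨D₂, hD₂, h₂⟩ := h'
  rw [hconn] at hD₁
  obtain rfl := hD₁.unique hD₂
  refine ConnectionData.ext hconn ?_
  funext k l hk hl hkl
  refine TwistField.ext (funext fun q => LinearMap.ext fun x => LinearMap.ext fun y => ?_)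
  -- Every pair of arguments at `q` extends to homogeneous fields; the common induced part then
  -- cancels.
  have e₁ := h₁ k l hk hl hkl _ _ (hasDegree_extend x.2) (hasDegree_extend y.2) q
  have e₂ := h₂ k l hk hl hkl _ _ (hasDegree_extend x.2) (hasDegree_extend y.2) q
  have hx : (⟨_, hasDegree_extend x.2 q⟩ : ⋀[ℝ]^k (Tan n q)) = x := Subtype.ext (evalAt_extend _)
  have hy : (⟨_, hasDegree_extend y.2 q⟩ : ⋀[ℝ]^l (Tan n q)) = y := Subtype.ext (evalAt_extend _)
  rw [hx, hy] at e₁ e₂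
  exact Subtype.ext (add_left_cancel (e₁.symm.trans e₂))

end Classification

end HigherConn

end

open HigherConn in
theorem theorem3p1 (n : ℕ) (M : Type*) [TopologicalSpace M] [T2Space M]
    [SecondCountableTopology M] [ChartedSpace (EuclideanSpace ℝ (Fin n)) M]
    [IsManifold (𝓡 n) ∞ M] :
    -- every affine connection has a unique extension to an induced higher connection
    (∀ A : AffineConnection n M, ∃! D : HigherConnection n M, D.IsInducedBy n A) ∧
    -- every higher connection decomposes uniquely
    (∀ D : HigherConnection n M, ∃! S : ConnectionData n M, Decomposes n D S) ∧
    -- every pair determines a unique higher connection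
    (∀ S : ConnectionData n M, ∃! D : HigherConnection n M, Decomposes n D S) ∧
    -- the correspondence is a bijection
    (∃ Φ : HigherConnection n M ≃ ConnectionData n M, ∀ D, Decomposes n D (Φ D)) :=
  ⟨existsUnique_inducedConnection,
    fun D => ⟨D.data, D.decomposes_data, fun _ h => h.data_unique D.decomposes_data⟩,
    fun S => ⟨S.higherConnection, S.decomposes, fun _ h => h.unique S.decomposes⟩,
    ⟨⟨HigherConnection.data, ConnectionData.higherConnection,
      fun D => D.data.decomposes.unique D.decomposes_data,
      fun S => S.higherConnection.decomposes_data.data_unique S.decomposes⟩,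
      HigherConnection.decomposes_data⟩⟩
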